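/- Let $(M,h)$ be a smooth Riemannian manifold of dimension $n\ge 1$ (Hausdorff, without boundary), let $W$ be a smooth vector field on $M$ (the wind) and let $|u|_h : M\to\mathbb{R}$ be a smooth function (the ship's own speed), with $|W(x)|_h<|u(x)|_h\le 1$ for all $x\in M$. A *trajectory* is a piecewise $C^1$ curve $\gamma$ in $M$ whose velocity is, at all but finitely many times of each compact interval, $\gamma'(t)=u+W(\gamma(t))$ with $h(u,u)=|u(\gamma(t))|_h^2$. A *solution of the generalized Zermelo navigation problem* on an open interval $J$ is a trajectory $\gamma:J\to M$ that is locally time-optimal: every $t_0\in J$ has a neighbourhood $U$ such that, for all $t_1\le t_2$ in $U\cap J$, no trajectory from $\gamma(t_1)$ to $\gamma(t_2)$ takes less time than $t_2-t_1$. Say that a solution is an *$h$-geodesic up to scaling by $c>0$* if it is a geodesic of $h$ traversed with constant speed $|\gamma'|_h=c$, that is, if $t\mapsto\gamma(t/c)$ is a unit speed $h$-geodesic. Then the following are equivalent: 1. there is one constant $c>0$ such that every solution is an $h$-geodesic up to scaling by $c$; 2. there is one constant $c>0$ such that the solutions on each open interval are exactly the $h$-geodesics of constant speed $c$; 3. $W=0$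 on $M$, and $h(u,u)=|u(x)|_h^2$ does not depend on $x$. -/

import Mathlib

open Set Filter Topology Manifold Bundle
open scoped ContDiff

namespace Zermelo

variable {E : Type*} [NormedAddCommGroup E] [NormedSpace ℝ E]
  {M : Type*} [TopologicalSpace M] [ChartedSpace E M] [IsManifold 𝓘(ℝ, E) ∞ M]

/-- A smooth Riemannian metric on the manifold `M`; `h.inner x v w` is `h(v, w)` for tangent
vectors `v, w` at `x`. -/
abbrev Metric (E : Type*) [NormedAddCommGroup E] [NormedSpace ℝ E]
    (M : Type*) [TopologicalSpace M] [ChartedSpace E M] [IsManifold 𝓘(ℝ, E) ∞ M] :=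
  ContMDiffRiemannianMetric 𝓘(ℝ, E) ∞ E (fun x : M => TangentSpace 𝓘(ℝ, E) x)

/-- The norm `|v|_h = √h(v, v)` of a tangent vector at `x`. -/
noncomputable def hnorm (h : Metric E M) (x : M) (v : TangentSpace 𝓘(ℝ, E) x) : ℝ :=
  Real.sqrt (h.inner x v v)

/-- The velocity `γ'(t)` of a curve in `M`. -/
noncomputable def velocity (E : Type*) [NormedAddCommGroup E] [NormedSpace ℝ E]
    {M : Type*} [TopologicalSpace M] [ChartedSpace E M]
    (γ : ℝ → M) (t : ℝ) : TangentSpace 𝓘(ℝ, E) (γ t) :=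
  mfderiv 𝓘(ℝ, ℝ) 𝓘(ℝ, E) γ t (1 : ℝ)

/-! ### The navigation problem -/

/-- `γ` restricted to `[a, b]` is a possible voyage of a ship whose speed relative to the medium
at the point `x` is `s x`, in the presence of the wind `W`: the curve is piecewise `C¹`, and
outside finitely many times its velocity is `γ' = u + W` with `|u|_h = s`. -/
def IsTrajectory (h : Metric E M) (W : ∀ x : M, TangentSpace 𝓘(ℝ, E) x) (s : M → ℝ)
    (γ : ℝ → M) (a b : ℝ) : Prop :=
  ContinuousOn γ (Icc a b) ∧
  ∃ S : Finset ℝ,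
    (∀ c d : ℝ, a ≤ c → c < d → d ≤ b → (∀ t ∈ Ioo c d, t ∉ S) →
      ContMDiffOn 𝓘(ℝ, ℝ) 𝓘(ℝ, E) 1 γ (Icc c d)) ∧
    ∀ t ∈ Ioo a b, t ∉ S → hnorm h (γ t) (velocity E γ t - W (γ t)) = s (γ t)

/-- `γ`, restricted to the open interval `J`, is a solution of the navigation problem with wind
`W` and ship's own speed `s`: it is a (locally) time-optimal trajectory. Around each time `t₀`,
no voyage from `γ t₁` to `γ t₂` takes less time than the time `t₂ - t₁` that `γ` takes. -/
def IsSolution (h : Metric E M) (W : ∀ x : M, TangentSpace 𝓘(ℝ, E) x) (s : M → ℝ)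
    (γ : ℝ → M) (J : Set ℝ) : Prop :=
  (∀ a ∈ J, ∀ b ∈ J, a ≤ b → IsTrajectory h W s γ a b) ∧
  ∀ t₀ ∈ J, ∃ U ∈ 𝓝 t₀, ∀ t₁ ∈ U ∩ J, ∀ t₂ ∈ U ∩ J, t₁ ≤ t₂ →
    ∀ (σ : ℝ → M) (T : ℝ), 0 ≤ T → IsTrajectory h W s σ 0 T → σ 0 = γ t₁ → σ T = γ t₂ →
      t₂ - t₁ ≤ T

/-! ### Riemannian geodesics -/

/-- The metric in the chart `φ`: the bilinear form `∑ h_ij(y) vⁱ wʲ`. -/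
noncomputable def chartMetric (h : Metric E M) (φ : OpenPartialHomeomorph M E) (y v w : E) : ℝ :=
  h.inner (φ.symm y) (mfderiv 𝓘(ℝ, E) 𝓘(ℝ, E) φ.symm y v) (mfderiv 𝓘(ℝ, E) 𝓘(ℝ, E) φ.symm y w)

/-- The Christoffel symbols of the first kind in the chart `φ`:
`Γ(u, v; w) = ½ (∂_u h(v, w) + ∂_v h(u, w) - ∂_w h(u, v))`. -/
noncomputable def christoffel (h : Metric E M) (φ : OpenPartialHomeomorph M E)
    (y u v w : E) : ℝ :=
  (fderiv ℝ (fun z => chartMetric h φ z v w) y u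
    + fderiv ℝ (fun z => chartMetric h φ z u w) y v
    - fderiv ℝ (fun z => chartMetric h φ z u v) y w) / 2

/-- `γ`, restricted to the open interval `J`, is a geodesic of `h` (with affine parameter): around
each time, in a chart, the curve is `C²` and satisfies the geodesic equation
`h(y'', w) + Γ(y', y'; w) = 0` for all `w`. -/
def IsGeodesic (h : Metric E M) (γ : ℝ → M) (J : Set ℝ) : Prop :=
  ∀ t₀ ∈ J, ∃ φ ∈ atlas E M, (∀ᶠ t in 𝓝 t₀, γ t ∈ φ.source) ∧ ContDiffAt ℝ 2 (φ ∘ γ) t₀ ∧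
    ∀ᶠ t in 𝓝 t₀, ∀ w : E,
      chartMetric h φ (φ (γ t)) (deriv (deriv (φ ∘ γ)) t) w
        + christoffel h φ (φ (γ t)) (deriv (φ ∘ γ) t) (deriv (φ ∘ γ) t) w = 0

/-- `γ` becomes a unit speed geodesic of `h` after rescaling time by the constant `c`: it is a
geodesic traversed with constant speed `c`. -/
def IsGeodesicOfSpeed (h : Metric E M) (c : ℝ) (γ : ℝ → M) (J : Set ℝ) : Prop :=
  IsGeodesic h γ J ∧ ∀ t ∈ J, hnorm h (γ t) (velocity E γ t) = c

end Zermelo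

/-!
In a chart, the condition `|γ' - W|_h = s` reads `L(y, y') = 0` for the quadratic Lagrangian
`L(y, v) = |v - W|² - s²`, and `|W|_h < s` says that `L(y, 0) < 0`. A faster voyage between the
same endpoints, slowed down to the original duration, would therefore make `L` negative. A curve
on which `L` vanishes and which solves the Euler-Lagrange equation of `λ L` for a positive
multiplier `λ(t)` excludes this on short time intervals, because `L` is strictly convex in the
velocity: such an extremal is locally time-optimal. Hamilton's equations produce an extremal with
any prescribed admissible initial velocity `u + W x`, `|u|_h = s x`. If all solutions have speed
`c`, then `|u + W x|_h = c` for all these `u`, and replacing `u` by `-u` gives `W x = 0` and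
`s x = c`. Conversely, without wind and for constant `s` a geodesic of speed `s` is an extremal
with constant multiplier, and a time-optimal trajectory must coincide with the short geodesic
between its endpoints.
-/

namespace Zermelo

open scoped NNReal

section Instances

/-! Instance search finds the structures below only after a long detour. -/

variable {E F G : Type*} [NormedAddCommGroup E] [NormedSpace ℝ E] [NormedAddCommGroup F]
  [NormedSpace ℝ F] [NormedAddCommGroup G] [NormedSpace ℝ G]

noncomputable instance instSeminormedAddCommGroupBilin :
    SeminormedAddCommGroup (E →L[ℝ] F →L[ℝ] G) := ContinuousLinearMap.toSeminormedAddCommGroup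

noncomputable instance instNormedAddCommGroupBilin :
    NormedAddCommGroup (E →L[ℝ] F →L[ℝ] G) := ContinuousLinearMap.toNormedAddCommGroup

noncomputable instance instNormedSpaceBilin :
    NormedSpace ℝ (E →L[ℝ] F →L[ℝ] G) := ContinuousLinearMap.toNormedSpace

end Instances

section Calculus

variable {E F : Type*} [NormedAddCommGroup E] [NormedSpace ℝ E]
  [NormedAddCommGroup F] [NormedSpace ℝ F]

theorem le_of_hasDerivAt_nonpos_of_notMem_finset {f f' : ℝ → ℝ} (S : Finset ℝ) {a b : ℝ}
    (hab : a ≤ b) (hf : ContinuousOn f (Icc a b))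
    (hf' : ∀ t ∈ Ioo a b, t ∉ S → HasDerivAt f (f' t) t)
    (hnonpos : ∀ t ∈ Ioo a b, t ∉ S → f' t ≤ 0) : f b ≤ f a := by
  induction S using Finset.induction generalizing a b with
  | empty =>
    refine antitoneOn_of_deriv_nonpos (convex_Icc a b) hf ?_ ?_
      (left_mem_Icc.2 hab) (right_mem_Icc.2 hab) hab <;> rw [interior_Icc]
    · exact fun t ht => (hf' t ht (by simp)).differentiableAt.differentiableWithinAt
    · exact fun t ht => (hf' t ht (by simp)).deriv ▸ hnonpos t ht (by simp)
  | insert s S _ ih =>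
    by_cases hs : s ∈ Icc a b
    · have hleft : f s ≤ f a := ih hs.1 (hf.mono (Icc_subset_Icc_right hs.2))
        (fun t ht htS => hf' t ⟨ht.1, ht.2.trans_le hs.2⟩ (by simp [ht.2.ne, htS]))
        (fun t ht htS => hnonpos t ⟨ht.1, ht.2.trans_le hs.2⟩ (by simp [ht.2.ne, htS]))
      have hright : f b ≤ f s := ih hs.2 (hf.mono (Icc_subset_Icc_left hs.1))
        (fun t ht htS => hf' t ⟨hs.1.trans_lt ht.1, ht.2⟩ (by simp [ht.1.ne', htS]))
        (fun t ht htS => hnonpos t ⟨hs.1.trans_lt ht.1, ht.2⟩ (by simp [ht.1.ne', htS]))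
      exact hright.trans hleft
    · have hne : ∀ t ∈ Ioo a b, t ≠ s := fun t ht hts => hs (hts ▸ Ioo_subset_Icc_self ht)
      exact ih hab hf (fun t ht htS => hf' t ht (by simp [hne t ht, htS]))
        (fun t ht htS => hnonpos t ht (by simp [hne t ht, htS]))

theorem deriv_eq_zero_of_nonpos_of_notMem_finset {f f' : ℝ → ℝ} (S : Finset ℝ) {a b : ℝ}
    (hf : ContinuousOn f (Icc a b)) (hf' : ∀ t ∈ Ioo a b, t ∉ S → HasDerivAt f (f' t) t)
    (hnonpos : ∀ t ∈ Ioo a b, t ∉ S → f' t ≤ 0) (hab : f a ≤ f b) {t : ℝ} (ht : t ∈ Ioo a b)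
    (htS : t ∉ S) : f' t = 0 := by
  have hanti : ∀ c ∈ Icc a b, ∀ d ∈ Icc a b, c ≤ d → f d ≤ f c := fun c hc d hd hcd =>
    le_of_hasDerivAt_nonpos_of_notMem_finset S hcd (hf.mono (Icc_subset_Icc hc.1 hd.2))
      (fun r hr => hf' r ⟨hc.1.trans_lt hr.1, hr.2.trans_le hd.2⟩)
      (fun r hr => hnonpos r ⟨hc.1.trans_lt hr.1, hr.2.trans_le hd.2⟩)
  have hle : a ≤ b := (ht.1.trans ht.2).le
  have hconst : ∀ r ∈ Icc a b, f r = f a := fun r hr =>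
    (hanti a (left_mem_Icc.2 hle) r hr hr.1).antisymm
      (hab.trans (hanti r hr b (right_mem_Icc.2 hle) hr.2))
  refine (hf' t ht htS).unique ((hasDerivAt_const t (f a)).congr_of_eventuallyEq ?_)
  filter_upwards [Icc_mem_nhds ht.1 ht.2] with r hr using hconst r hr

theorem norm_sub_le_of_hasDerivAt_of_notMem_finset {f f' : ℝ → E} (S : Finset ℝ) {a b C : ℝ}
    (hab : a ≤ b) (hf : ContinuousOn f (Icc a b))
    (hf' : ∀ t ∈ Ioo a b, t ∉ S → HasDerivAt f (f' t) t)
    (hbound : ∀ t ∈ Ioo a b, t ∉ S → ‖f' t‖ ≤ C) : ‖f b - f a‖ ≤ C * (b - a) := by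
  obtain ⟨g, hg, hgf⟩ := exists_dual_vector'' ℝ (f b - f a)
  have hderiv : ∀ t ∈ Ioo a b, t ∉ S → HasDerivAt (fun r => g (f r) - C * r) (g (f' t) - C) t :=
    fun t ht htS => (g.hasFDerivAt.comp_hasDerivAt t (hf' t ht htS)).sub
      (hasDerivAt_const_mul C)
  have hnonpos : ∀ t ∈ Ioo a b, t ∉ S → g (f' t) - C ≤ 0 := fun t ht htS => by
    have hgC : ‖g (f' t)‖ ≤ 1 * C := g.le_of_opNorm_le_of_le hg (hbound t ht htS)
    linarith [le_of_abs_le hgC]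
  have := le_of_hasDerivAt_nonpos_of_notMem_finset S hab (by fun_prop) hderiv hnonpos
  rw [map_sub, RCLike.ofReal_real_eq_id, id] at hgf
  linarith

theorem eqOn_Icc_of_eqOn_Ioo_diff_finset {Y : Type*} [TopologicalSpace Y] [T2Space Y]
    {f g : ℝ → Y} (S : Finset ℝ) {a b : ℝ} (hab : a < b) (hf : ContinuousOn f (Icc a b))
    (hg : ContinuousOn g (Icc a b)) (hfg : ∀ t ∈ Ioo a b, t ∉ S → f t = g t) :
    EqOn f g (Icc a b) := by
  have hdense : Icc a b ⊆ closure (Ioo a b ∩ (univ \ S)) := by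
    rw [← closure_Ioo hab.ne]
    exact closure_minimal
      ((dense_univ.sdiff_finset S).open_subset_closure_inter isOpen_Ioo) isClosed_closure
  exact EqOn.of_subset_closure (fun t ht => hfg t ht.1 ht.2.2) hf hg
    (inter_subset_left.trans Ioo_subset_Icc_self) hdense

theorem eventually_forall_segment {p : E → Prop} {y₀ : E} (hp : ∀ᶠ y in 𝓝 y₀, p y) :
    ∀ᶠ q : E × E in 𝓝 (y₀, y₀), ∀ z ∈ segment ℝ q.1 q.2, p z := by
  obtain ⟨r, hr, hball⟩ := Metric.eventually_nhds_iff_ball.1 hp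
  filter_upwards [prod_mem_nhds (Metric.ball_mem_nhds y₀ hr) (Metric.ball_mem_nhds y₀ hr)]
    with q hq z hz
  exact hball z ((convex_ball y₀ r).segment_subset hq.1 hq.2 hz)

theorem exists_lipschitz_bound {f : E → F} {y₀ : E} (hf : ContDiffAt ℝ 1 f y₀) :
    ∃ K > 0, ∀ᶠ q : E × E in 𝓝 (y₀, y₀), ‖f q.2 - f q.1‖ ≤ K * ‖q.2 - q.1‖ := by
  obtain ⟨K, s, hs, hK⟩ := hf.exists_lipschitzOnWith
  refine ⟨K + 1, by positivity, ?_⟩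
  filter_upwards [prod_mem_nhds hs hs] with q hq
  calc ‖f q.2 - f q.1‖ ≤ K * ‖q.2 - q.1‖ := hK.norm_sub_le hq.2 hq.1
    _ ≤ (K + 1) * ‖q.2 - q.1‖ := by gcongr; simp

theorem exists_taylor_bound {f : E → F} {y₀ : E} (hf : ContDiffAt ℝ 2 f y₀) :
    ∃ K > 0, ∀ᶠ q : E × E in 𝓝 (y₀, y₀),
      ‖f q.2 - f q.1 - fderiv ℝ f q.1 (q.2 - q.1)‖ ≤ K * ‖q.2 - q.1‖ ^ 2 := by
  obtain ⟨K, s, hs, hK⟩ := (hf.fderiv_right (m := 1) (by norm_num)).exists_lipschitzOnWith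
  have hdiff : ∀ᶠ y in 𝓝 y₀, DifferentiableAt ℝ f y :=
    (hf.eventually (by simp)).mono fun y hy => hy.differentiableAt (by norm_num)
  refine ⟨K + 1, by positivity, ?_⟩
  filter_upwards [eventually_forall_segment (hdiff.and hs)] with q hq
  have hlip : ∀ z ∈ segment ℝ q.1 q.2, ‖fderiv ℝ f z - fderiv ℝ f q.1‖ ≤ K * ‖q.2 - q.1‖ := by
    intro z hz
    refine (hK.norm_sub_le (hq z hz).2 (hq q.1 (left_mem_segment ℝ q.1 q.2)).2).trans ?_
    gcongr
    exact norm_sub_le_of_mem_segment hz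
  calc ‖f q.2 - f q.1 - fderiv ℝ f q.1 (q.2 - q.1)‖
      ≤ K * ‖q.2 - q.1‖ * ‖q.2 - q.1‖ :=
        (convex_segment q.1 q.2).norm_image_sub_le_of_norm_hasFDerivWithin_le'
          (fun z hz => (hq z hz).1.hasFDerivAt.hasFDerivWithinAt) hlip
          (left_mem_segment ℝ q.1 q.2) (right_mem_segment ℝ q.1 q.2)
    _ = K * ‖q.2 - q.1‖ ^ 2 := by ring
    _ ≤ (K + 1) * ‖q.2 - q.1‖ ^ 2 := by gcongr; simp

theorem exists_forall_mul_norm_sq_le_of_pos [FiniteDimensional ℝ E] {B : E →L[ℝ] E →L[ℝ] ℝ}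
    (hB : ∀ v ≠ 0, 0 < B v v) : ∃ a > 0, ∀ v, a * ‖v‖ ^ 2 ≤ B v v := by
  rcases subsingleton_or_nontrivial E with _ | _
  · exact ⟨1, one_pos, fun v => by simp [Subsingleton.elim v 0]⟩
  obtain ⟨u, hu, hmin⟩ := (isCompact_sphere (0 : E) 1).exists_isMinOn
    (NormedSpace.sphere_nonempty.2 zero_le_one) (f := fun v => B v v) (by fun_prop)
  refine ⟨B u u, hB u (ne_zero_of_mem_unit_sphere ⟨u, hu⟩), fun v => ?_⟩
  rcases eq_or_ne v 0 with rfl | hv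
  · simp
  have hv' : ‖v‖ ≠ 0 := norm_ne_zero_iff.2 hv
  have hle : B u u ≤ B (‖v‖⁻¹ • v) (‖v‖⁻¹ • v) := hmin (by simp [norm_smul, hv'])
  simp only [map_smul, smul_apply, smul_eq_mul] at hle
  calc B u u * ‖v‖ ^ 2 ≤ ‖v‖⁻¹ * (‖v‖⁻¹ * B v v) * ‖v‖ ^ 2 := by gcongr
    _ = B v v := by field_simp

theorem exists_eventually_mul_norm_sq_le_of_pos [FiniteDimensional ℝ E]
    {B : E → E →L[ℝ] E →L[ℝ] ℝ} {y₀ : E} (hcont : ContinuousAt B y₀)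
    (hpos : ∀ v ≠ 0, 0 < B y₀ v v) : ∃ a > 0, ∀ᶠ y in 𝓝 y₀, ∀ v, a * ‖v‖ ^ 2 ≤ B y v v := by
  obtain ⟨a, ha, hlow⟩ := exists_forall_mul_norm_sq_le_of_pos hpos
  refine ⟨a / 2, half_pos ha, ?_⟩
  filter_upwards [hcont.eventually (Metric.ball_mem_nhds _ (half_pos ha))] with y hy v
  rw [dist_eq_norm] at hy
  have hdiff : |(B y - B y₀) v v| ≤ a / 2 * ‖v‖ * ‖v‖ :=
    ((B y - B y₀).le_opNorm₂ v v).trans (by gcongr)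
  rw [sub_apply, sub_apply] at hdiff
  linarith [hlow v, neg_le_of_abs_le hdiff]

theorem contDiffAt_succ_of_hasDerivAt {n : ℕ} {y v : ℝ → E} {t : ℝ}
    (hy : ∀ᶠ r in 𝓝 t, HasDerivAt y (v r) r)
    (hv : ContDiffAt ℝ n v t) : ContDiffAt ℝ (n + 1) y t :=
  contDiffAt_succ_iff_hasFDerivAt.2 ⟨fun r => ContinuousLinearMap.toSpanSingleton ℝ (v r),
    ⟨_, hy, fun _ hr => hr⟩,
    (ContinuousLinearMap.toSpanSingletonCLE (𝕜 := ℝ) (E := E)).contDiff.contDiffAt.comp t hv⟩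

theorem contDiffAt_one_of_hasDerivAt {y v : ℝ → E} {t : ℝ}
    (hy : ∀ᶠ r in 𝓝 t, HasDerivAt y (v r) r)
    (hv : ∀ᶠ r in 𝓝 t, ContinuousAt v r) : ContDiffAt ℝ 1 y t := by
  simpa using contDiffAt_succ_of_hasDerivAt (n := 0) hy
    (contDiffAt_zero.2 ⟨_, hv, fun _ hr => hr.continuousWithinAt⟩)

end Calculus

/-- A quadratic Lagrangian on a vector space: the function `quad y v v + lin y v + const y` of
position `y` and velocity `v`, given by its coefficients. -/
structure QuadLagrangian (E : Type*) [NormedAddCommGroup E] [NormedSpace ℝ E] where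
  quad : E → E →L[ℝ] E →L[ℝ] ℝ
  lin : E → E →L[ℝ] ℝ
  const : E → ℝ

namespace QuadLagrangian

variable {E : Type*} [NormedAddCommGroup E] [NormedSpace ℝ E]

/-- The value of a quadratic Lagrangian at position `y` and velocity `v`. -/
noncomputable def eval (L : QuadLagrangian E) (y v : E) : ℝ :=
  L.quad y v v + L.lin y v + L.const y

/-- The partial derivative of a quadratic Lagrangian with respect to the velocity. The form
`L.quad y` is understood to be symmetric. -/
noncomputable def velDeriv (L : QuadLagrangian E) (y v : E) : E →L[ℝ] ℝ :=
  (2 : ℝ) • L.quad y v + L.lin y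

/-- The partial derivative of a quadratic Lagrangian with respect to the position. -/
noncomputable def posDeriv (L : QuadLagrangian E) (y v : E) : E →L[ℝ] ℝ :=
  ((fderiv ℝ L.quad y).flip v).flip v + (fderiv ℝ L.lin y).flip v + fderiv ℝ L.const y

theorem velDeriv_apply (L : QuadLagrangian E) (y v w : E) :
    L.velDeriv y v w = 2 * L.quad y v w + L.lin y w := by
  simp [velDeriv]

theorem posDeriv_apply (L : QuadLagrangian E) (y v ξ : E) :
    L.posDeriv y v ξ = fderiv ℝ L.quad y ξ v v + fderiv ℝ L.lin y ξ v + fderiv ℝ L.const y ξ := by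
  simp [posDeriv]

theorem eval_add {L : QuadLagrangian E} {y : E} (hsymm : ∀ v w, L.quad y v w = L.quad y w v)
    (v w : E) : L.eval y (v + w) = L.eval y v + L.velDeriv y v w + L.quad y w w := by
  simp only [eval, velDeriv_apply, map_add, add_apply, hsymm w v]
  ring

/-- Regularity of a quadratic Lagrangian near `y₀`: the coefficients are `C²`, and the leading
coefficient is symmetric and positive definite. -/
structure IsRegularAt (L : QuadLagrangian E) (y₀ : E) : Prop where
  contDiffAt_quad : ContDiffAt ℝ 2 L.quad y₀
  contDiffAt_lin : ContDiffAt ℝ 2 L.lin y₀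
  contDiffAt_const : ContDiffAt ℝ 2 L.const y₀
  symm : ∀ᶠ y in 𝓝 y₀, ∀ v w, L.quad y v w = L.quad y w v
  pos : ∀ v ≠ 0, 0 < L.quad y₀ v v

/-- The curve `x` has velocity `v` at time `t` and satisfies there the Euler–Lagrange equation
`(μ ∂L/∂v)' = μ ∂L/∂y`. The factor `μ` is a Lagrange multiplier: the extremals of the navigation
problem are those of minimal time among the curves on which `L` vanishes. -/
structure IsExtremalAt (L : QuadLagrangian E) (μ : ℝ → ℝ) (x v : ℝ → E) (t : ℝ) : Prop where
  hasDerivAt : HasDerivAt x (v t) t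
  euler_lagrange : HasDerivAt (fun r => μ r • L.velDeriv (x r) (v r))
    (μ t • L.posDeriv (x t) (v t)) t

variable {L : QuadLagrangian E} {y₀ : E}

theorem IsExtremalAt.congr_of_eventuallyEq {μ : ℝ → ℝ} {x z v : ℝ → E} {t : ℝ}
    (hx : L.IsExtremalAt μ x v t) (hz : z =ᶠ[𝓝 t] x) : L.IsExtremalAt μ z v t :=
  ⟨hx.hasDerivAt.congr_of_eventuallyEq hz, hz.self_of_nhds ▸
    hx.euler_lagrange.congr_of_eventuallyEq (hz.mono fun r hr => by simp only [hr])⟩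

theorem exists_norm_velDeriv_sub_le (hquad : ContDiffAt ℝ 1 L.quad y₀)
    (hlin : ContDiffAt ℝ 1 L.lin y₀) :
    ∃ K > 0, ∀ᶠ q : E × E in 𝓝 (y₀, y₀), ∀ v,
      ‖L.velDeriv q.2 v - L.velDeriv q.1 v‖ ≤ K * (1 + ‖v‖) * ‖q.2 - q.1‖ := by
  obtain ⟨K₁, hK₁, h₁⟩ := exists_lipschitz_bound hquad
  obtain ⟨K₂, hK₂, h₂⟩ := exists_lipschitz_bound hlin
  refine ⟨2 * K₁ + K₂, by positivity, ?_⟩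
  filter_upwards [h₁, h₂] with q hq₁ hq₂ v
  calc ‖L.velDeriv q.2 v - L.velDeriv q.1 v‖
      = ‖(2 : ℝ) • (L.quad q.2 - L.quad q.1) v + (L.lin q.2 - L.lin q.1)‖ := by
        simp only [velDeriv, sub_apply, smul_sub]
        abel_nf
    _ ≤ 2 * (‖L.quad q.2 - L.quad q.1‖ * ‖v‖) + ‖L.lin q.2 - L.lin q.1‖ := by
        refine (norm_add_le _ _).trans (add_le_add_left ?_ _)
        rw [norm_smul, Real.norm_ofNat]
        gcongr
        exact (L.quad q.2 - L.quad q.1).le_opNorm v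
    _ ≤ 2 * (K₁ * ‖q.2 - q.1‖ * (1 + ‖v‖)) + K₂ * ‖q.2 - q.1‖ * (1 + ‖v‖) := by
        refine add_le_add ?_ (hq₂.trans (le_mul_of_one_le_right (by positivity) (by simp)))
        gcongr
        simp
    _ = (2 * K₁ + K₂) * (1 + ‖v‖) * ‖q.2 - q.1‖ := by ring

theorem exists_abs_eval_sub_posDeriv_le (hquad : ContDiffAt ℝ 2 L.quad y₀)
    (hlin : ContDiffAt ℝ 2 L.lin y₀) (hconst : ContDiffAt ℝ 2 L.const y₀) :
    ∃ K > 0, ∀ᶠ q : E × E in 𝓝 (y₀, y₀), ∀ v,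
      |L.eval q.2 v - L.eval q.1 v - L.posDeriv q.1 v (q.2 - q.1)| ≤
        K * (1 + ‖v‖) ^ 2 * ‖q.2 - q.1‖ ^ 2 := by
  obtain ⟨K₁, hK₁, h₁⟩ := exists_taylor_bound hquad
  obtain ⟨K₂, hK₂, h₂⟩ := exists_taylor_bound hlin
  obtain ⟨K₃, hK₃, h₃⟩ := exists_taylor_bound hconst
  refine ⟨K₁ + K₂ + K₃, by positivity, ?_⟩
  filter_upwards [h₁, h₂, h₃] with ⟨x, y⟩ hq₁ hq₂ hq₃ v
  dsimp only at hq₁ hq₂ hq₃ ⊢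
  have hv : ‖v‖ ≤ 1 + ‖v‖ := by simp
  have hone : 1 ≤ 1 + ‖v‖ := by simp
  have hquad : |(L.quad y - L.quad x - fderiv ℝ L.quad x (y - x)) v v| ≤
      K₁ * ‖y - x‖ ^ 2 * (1 + ‖v‖) * (1 + ‖v‖) :=
    ((L.quad y - L.quad x - fderiv ℝ L.quad x (y - x)).le_opNorm₂ v v).trans (by gcongr)
  have hlin : |(L.lin y - L.lin x - fderiv ℝ L.lin x (y - x)) v| ≤
      K₂ * ‖y - x‖ ^ 2 * (1 + ‖v‖) * (1 + ‖v‖) :=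
    (((L.lin y - L.lin x - fderiv ℝ L.lin x (y - x)).le_opNorm v).trans (by gcongr)).trans
      (le_mul_of_one_le_right (by positivity) hone)
  have hconst : |L.const y - L.const x - fderiv ℝ L.const x (y - x)| ≤
      K₃ * ‖y - x‖ ^ 2 * (1 + ‖v‖) * (1 + ‖v‖) :=
    (hq₃.trans (le_mul_of_one_le_right (by positivity) hone)).trans
      (le_mul_of_one_le_right (by positivity) hone)
  calc |L.eval y v - L.eval x v - L.posDeriv x v (y - x)|
      = |(L.quad y - L.quad x - fderiv ℝ L.quad x (y - x)) v v
          + (L.lin y - L.lin x - fderiv ℝ L.lin x (y - x)) v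
          + (L.const y - L.const x - fderiv ℝ L.const x (y - x))| := by
        rw [posDeriv_apply]
        simp only [eval, sub_apply]
        ring_nf
    _ ≤ _ := (abs_add_three _ _ _).trans (add_le_add_three hquad hlin hconst)
    _ = (K₁ + K₂ + K₃) * (1 + ‖v‖) ^ 2 * ‖y - x‖ ^ 2 := by ring

theorem IsRegularAt.exists_lower_bound [FiniteDimensional ℝ E] (hL : L.IsRegularAt y₀) :
    ∃ a > 0, ∃ C > 0, ∀ᶠ q : E × E in 𝓝 (y₀, y₀), ∀ v w,
      L.eval q.1 v + L.posDeriv q.1 v (q.2 - q.1) + L.velDeriv q.1 v w + a * ‖w‖ ^ 2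
        - C * (1 + ‖v‖) ^ 2 * ‖q.2 - q.1‖ ^ 2 ≤ L.eval q.2 (v + w) := by
  obtain ⟨a, ha, hpos⟩ :=
    exists_eventually_mul_norm_sq_le_of_pos hL.contDiffAt_quad.continuousAt hL.pos
  obtain ⟨K₁, hK₁, h₁⟩ := exists_abs_eval_sub_posDeriv_le hL.contDiffAt_quad hL.contDiffAt_lin
    hL.contDiffAt_const
  obtain ⟨K₂, hK₂, h₂⟩ := exists_norm_velDeriv_sub_le (hL.contDiffAt_quad.of_le one_le_two)
    (hL.contDiffAt_lin.of_le one_le_two)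
  refine ⟨a / 2, half_pos ha, K₁ + K₂ ^ 2 / (2 * a), by positivity, ?_⟩
  filter_upwards [h₁, h₂, (hL.symm.and hpos).prod_inr_nhds y₀] with ⟨x, y⟩ hq₁ hq₂ ⟨hsymm, hy⟩ v w
  dsimp only at hq₁ hq₂ hsymm hy ⊢
  have hvel : |L.velDeriv y v w - L.velDeriv x v w| ≤ K₂ * (1 + ‖v‖) * ‖y - x‖ * ‖w‖ :=
    ((L.velDeriv y v - L.velDeriv x v).le_opNorm w).trans (by gcongr; exact hq₂ v)
  have hyoung : K₂ * (1 + ‖v‖) * ‖y - x‖ * ‖w‖ ≤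
      a / 2 * ‖w‖ ^ 2 + K₂ ^ 2 / (2 * a) * (1 + ‖v‖) ^ 2 * ‖y - x‖ ^ 2 := by
    rw [← sub_nonneg]
    calc 0 ≤ (a * ‖w‖ - K₂ * (1 + ‖v‖) * ‖y - x‖) ^ 2 / (2 * a) := by positivity
      _ = _ := by field_simp; ring
  rw [eval_add hsymm]
  linarith [neg_le_of_abs_le (hq₁ v), neg_le_of_abs_le hvel, hy w]

theorem neg_mul_form_sub_le {Q : E →L[ℝ] E →L[ℝ] ℝ} {q b N τ : ℝ}
    (hQ : ∀ ξ, q * ‖ξ‖ ^ 2 ≤ Q ξ ξ) (hb : 0 < b) (hN : 0 ≤ N) (hτ : τ ∈ Icc 0 1) (ξ w : E) :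
    -(N * Q ξ ξ) - 2 * τ * Q ξ w ≤ b * ‖w‖ ^ 2 + (‖Q‖ ^ 2 / b - N * q) * ‖ξ‖ ^ 2 := by
  have hcross : -(τ * Q ξ w) ≤ ‖Q‖ * ‖ξ‖ * ‖w‖ := by
    calc -(τ * Q ξ w) ≤ |τ| * |Q ξ w| := abs_mul τ _ ▸ neg_le_abs _
      _ ≤ 1 * (‖Q‖ * ‖ξ‖ * ‖w‖) := by
        gcongr
        · exact abs_le.2 ⟨by linarith [hτ.1], hτ.2⟩
        · exact Q.le_opNorm₂ ξ w
      _ = _ := one_mul _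
  have hyoung : 2 * (‖Q‖ * ‖ξ‖ * ‖w‖) ≤ b * ‖w‖ ^ 2 + ‖Q‖ ^ 2 / b * ‖ξ‖ ^ 2 := by
    rw [← sub_nonneg]
    calc 0 ≤ (b * ‖w‖ - ‖Q‖ * ‖ξ‖) ^ 2 / b := by positivity
      _ = _ := by field_simp; ring
  linarith [mul_le_mul_of_nonneg_left (hQ ξ) hN]

theorem hasDerivAt_apply_sub_mul_form {Q : E →L[ℝ] E →L[ℝ] ℝ} (hQ : ∀ v w, Q v w = Q w v)
    {p : ℝ → E →L[ℝ] ℝ} {p' : E →L[ℝ] ℝ} {ξ : ℝ → E} {w : E} {t : ℝ} (hp : HasDerivAt p p' t)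
    (hξ : HasDerivAt ξ w t) (N t₁ : ℝ) :
    HasDerivAt (fun r => p r (ξ r) - N * (r - t₁) * Q (ξ r) (ξ r))
      (p' (ξ t) + p t w + (-(N * Q (ξ t) (ξ t)) - 2 * (N * (t - t₁)) * Q (ξ t) w)) t := by
  have hform : HasDerivAt (fun r => Q (ξ r) (ξ r)) (Q w (ξ t) + Q (ξ t) w) t :=
    (Q.hasFDerivAt.comp_hasDerivAt t hξ).clm_apply hξ
  have hlin : HasDerivAt (fun r => N * (r - t₁)) (N * 1) t :=
    ((hasDerivAt_id t).sub_const t₁).const_mul N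
  refine ((hp.clm_apply hξ).sub (hlin.mul hform)).congr_deriv ?_
  rw [hQ w (ξ t)]
  ring

theorem smul_posDeriv_add_smul_velDeriv_le {a C m₀ m₁ R μ : ℝ} {x y v u : E}
    (hlow : L.eval x v + L.posDeriv x v (y - x) + L.velDeriv x v (u - v) + a * ‖u - v‖ ^ 2
      - C * (1 + ‖v‖) ^ 2 * ‖y - x‖ ^ 2 ≤ L.eval y u)
    (hle : L.eval y u ≤ L.eval x v) (ha : 0 ≤ a) (hC : 0 ≤ C) (hv : ‖v‖ ≤ R) (hm₀ : 0 ≤ m₀)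
    (hμ : μ ∈ Icc m₀ m₁) :
    (μ • L.posDeriv x v) (y - x) + (μ • L.velDeriv x v) (u - v) ≤
      m₁ * (C * (1 + R) ^ 2) * ‖y - x‖ ^ 2 - m₀ * a * ‖u - v‖ ^ 2 := by
  have hμ₀ : 0 ≤ μ := hm₀.trans hμ.1
  calc (μ • L.posDeriv x v) (y - x) + (μ • L.velDeriv x v) (u - v)
      = μ * (L.posDeriv x v (y - x) + L.velDeriv x v (u - v)) := by
        simp only [smul_apply, smul_eq_mul]
        ring
    _ ≤ μ * (C * (1 + ‖v‖) ^ 2 * ‖y - x‖ ^ 2 - a * ‖u - v‖ ^ 2) := by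
        gcongr
        linarith
    _ = μ * (C * (1 + ‖v‖) ^ 2) * ‖y - x‖ ^ 2 - μ * a * ‖u - v‖ ^ 2 := by ring
    _ ≤ m₁ * (C * (1 + R) ^ 2) * ‖y - x‖ ^ 2 - m₀ * a * ‖u - v‖ ^ 2 := by
        have := hμ₀.trans hμ.2
        gcongr
        exacts [hμ.2, hμ.1]

theorem exists_calibration_bound [FiniteDimensional ℝ E] {Q : E →L[ℝ] E →L[ℝ] ℝ}
    (hQ : ∀ v ≠ 0, 0 < Q v v) (k : ℝ) {b : ℝ} (hb : 0 < b) :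
    ∃ N > 0, ∀ τ ∈ Icc (0 : ℝ) 1, ∀ ξ w,
      k * ‖ξ‖ ^ 2 - b * ‖w‖ ^ 2 + (-(N * Q ξ ξ) - 2 * τ * Q ξ w) ≤ -‖ξ‖ ^ 2 := by
  obtain ⟨q, hq, hpos⟩ := exists_forall_mul_norm_sq_le_of_pos hQ
  refine ⟨(|k| + ‖Q‖ ^ 2 / b + 1) / q, by positivity, fun τ hτ ξ w => ?_⟩
  have hform :=
    neg_mul_form_sub_le (N := (|k| + ‖Q‖ ^ 2 / b + 1) / q) hpos hb (by positivity) hτ ξ w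
  rw [div_mul_cancel₀ _ hq.ne'] at hform
  have hk : k * ‖ξ‖ ^ 2 ≤ |k| * ‖ξ‖ ^ 2 := by
    gcongr
    exact le_abs_self k
  linarith

theorem eq_zero_of_calibration_decreasing {Q : E →L[ℝ] E →L[ℝ] ℝ} (hQ : ∀ v w, Q v w = Q w v)
    {p p' : ℝ → E →L[ℝ] ℝ} {ξ w : ℝ → E} {t₁ t₂ N : ℝ} (S : Finset ℝ)
    (hp : ∀ t ∈ Icc t₁ t₂, HasDerivAt p (p' t) t) (hξ : ContinuousOn ξ (Icc t₁ t₂))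
    (hξ' : ∀ t ∈ Ioo t₁ t₂, t ∉ S → HasDerivAt ξ (w t) t) (h₁ : ξ t₁ = 0) (h₂ : ξ t₂ = 0)
    (hdecay : ∀ t ∈ Ioo t₁ t₂, t ∉ S → p' t (ξ t) + p t (w t)
      + (-(N * Q (ξ t) (ξ t)) - 2 * (N * (t - t₁)) * Q (ξ t) (w t)) ≤ -‖ξ t‖ ^ 2)
    {t : ℝ} (ht : t ∈ Ioo t₁ t₂) (htS : t ∉ S) : ξ t = 0 := by
  have hpc : ContinuousOn p (Icc t₁ t₂) := fun r hr =>
    (hp r hr).continuousAt.continuousWithinAt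
  have hcont : ContinuousOn (fun r => p r (ξ r) - N * (r - t₁) * Q (ξ r) (ξ r)) (Icc t₁ t₂) :=
    (hpc.clm_apply hξ).sub (ContinuousOn.mul (by fun_prop)
      ((Q.continuous.comp_continuousOn hξ).clm_apply hξ))
  have hzero := deriv_eq_zero_of_nonpos_of_notMem_finset S hcont
    (fun r hr hrS => hasDerivAt_apply_sub_mul_form hQ (hp r (Ioo_subset_Icc_self hr))
      (hξ' r hr hrS) N t₁)
    (fun r hr hrS => (hdecay r hr hrS).trans (by simp)) (by simp [h₁, h₂]) ht htS
  have hsq : ‖ξ t‖ ^ 2 ≤ 0 := by linarith [hdecay t ht htS]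
  simpa using hsq.antisymm (sq_nonneg _)

/-- The calibration function is `p(ξ) - N (t - t₁) Q(ξ, ξ)`, where `x` is the extremal, `ξ = z - x`,
`p = μ ∂L/∂v` is its momentum and `Q = L.quad y₀`. It vanishes at both ends. -/
theorem IsRegularAt.exists_eqOn_of_isExtremalAt [FiniteDimensional ℝ E] (hL : L.IsRegularAt y₀)
    (R m₁ : ℝ) {m₀ : ℝ} (hm₀ : 0 < m₀) :
    ∃ V ∈ 𝓝 y₀, ∃ ε > 0, ∀ (t₁ t₂ : ℝ) (x v z u : ℝ → E) (μ : ℝ → ℝ) (S : Finset ℝ),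
      t₂ - t₁ ≤ ε →
      (∀ t ∈ Icc t₁ t₂, L.IsExtremalAt μ x v t ∧ x t ∈ V ∧ ‖v t‖ ≤ R ∧ μ t ∈ Icc m₀ m₁) →
      ContinuousOn z (Icc t₁ t₂) → MapsTo z (Icc t₁ t₂) V →
      (∀ t ∈ Ioo t₁ t₂, t ∉ S →
        HasDerivAt z (u t) t ∧ L.eval (z t) (u t) ≤ L.eval (x t) (v t)) →
      z t₁ = x t₁ → z t₂ = x t₂ → EqOn z x (Icc t₁ t₂) := by
  obtain ⟨a, ha, C, hC, hlow⟩ := hL.exists_lower_bound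
  obtain ⟨V, hV, hVV⟩ := mem_prod_same_iff.1 (nhds_prod_eq (x := y₀) (y := y₀) ▸ hlow)
  obtain ⟨N, hN, hcalib⟩ :=
    exists_calibration_bound hL.pos (m₁ * (C * (1 + R) ^ 2)) (mul_pos hm₀ ha)
  refine ⟨V, hV, N⁻¹, by positivity, ?_⟩
  intro t₁ t₂ x v z u μ S hε hx hz hzV hzd h₁ h₂
  have hxc : ContinuousOn x (Icc t₁ t₂) := fun t ht =>
    (hx t ht).1.hasDerivAt.continuousAt.continuousWithinAt
  have hzx : ∀ t ∈ Ioo t₁ t₂, t ∉ S → z t - x t = 0 := fun t ht htS => by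
    refine eq_zero_of_calibration_decreasing (N := N) (w := fun r => u r - v r)
      hL.symm.self_of_nhds S (fun r hr => (hx r hr).1.euler_lagrange) (hz.sub hxc)
      (fun r hr hrS => (hzd r hr hrS).1.sub (hx r (Ioo_subset_Icc_self hr)).1.hasDerivAt)
      (by simp [h₁]) (by simp [h₂]) (fun r hr hrS => ?_) ht htS
    obtain ⟨-, hxV, hvR, hμ⟩ := hx r (Ioo_subset_Icc_self hr)
    have hτ : N * (r - t₁) ∈ Icc 0 1 := by
      refine ⟨mul_nonneg hN.le (by linarith [hr.1]), ?_⟩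
      rw [← mul_inv_cancel₀ hN.ne']
      gcongr
      linarith [hr.2]
    have hexp := hVV (mk_mem_prod hxV (hzV (Ioo_subset_Icc_self hr))) (v r) (u r - v r)
    rw [add_sub_cancel] at hexp
    exact (add_le_add_left (smul_posDeriv_add_smul_velDeriv_le hexp (hzd r hr hrS).2 ha.le hC.le
      hvR hm₀.le hμ) _).trans (hcalib _ hτ (z r - x r) (u r - v r))
  rcases lt_trichotomy t₁ t₂ with hlt | rfl | hlt
  · exact eqOn_Icc_of_eqOn_Ioo_diff_finset S hlt hz hxc fun t ht htS =>
      sub_eq_zero.1 (hzx t ht htS)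
  · simpa using h₁
  · simp [Icc_eq_empty_of_lt hlt]

theorem IsRegularAt.not_eval_neg_of_isExtremalAt [FiniteDimensional ℝ E] (hL : L.IsRegularAt y₀)
    (R m₁ : ℝ) {m₀ : ℝ} (hm₀ : 0 < m₀) :
    ∃ V ∈ 𝓝 y₀, ∃ ε > 0, ∀ (t₁ t₂ : ℝ) (x v z u : ℝ → E) (μ : ℝ → ℝ) (S : Finset ℝ),
      t₁ < t₂ → t₂ - t₁ ≤ ε →
      (∀ t ∈ Icc t₁ t₂, L.IsExtremalAt μ x v t ∧ x t ∈ V ∧ ‖v t‖ ≤ R ∧ μ t ∈ Icc m₀ m₁) →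
      (∀ t ∈ Icc t₁ t₂, L.eval (x t) (v t) = 0) →
      ContinuousOn z (Icc t₁ t₂) → MapsTo z (Icc t₁ t₂) V →
      z t₁ = x t₁ → z t₂ = x t₂ →
      ¬ ∀ t ∈ Ioo t₁ t₂, t ∉ S → HasDerivAt z (u t) t ∧ L.eval (z t) (u t) < 0 := by
  obtain ⟨V, hV, ε, hε, huniq⟩ := hL.exists_eqOn_of_isExtremalAt R m₁ hm₀
  refine ⟨V, hV, ε, hε, fun t₁ t₂ x v z u μ S hlt hle hx hnull hz hzV h₁ h₂ hneg => ?_⟩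
  have heq : EqOn z x (Icc t₁ t₂) := huniq t₁ t₂ x v z u μ S hle hx hz hzV
    (fun t ht htS => ⟨(hneg t ht htS).1,
      (hnull t (Ioo_subset_Icc_self ht)).symm ▸ (hneg t ht htS).2.le⟩) h₁ h₂
  obtain ⟨t, ht, htS⟩ := ((Ioo_infinite hlt).sdiff S.finite_toSet).nonempty
  have hxt := (hx t (Ioo_subset_Icc_self ht)).1.hasDerivAt
  have huv : u t = v t := (hneg t ht htS).1.unique <| hxt.congr_of_eventuallyEq <|
    (heq.mono Ioo_subset_Icc_self).eventuallyEq_of_mem (Ioo_mem_nhds ht.1 ht.2)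
  have hlt := (hneg t ht htS).2
  rw [huv, heq (Ioo_subset_Icc_self ht), hnull t (Ioo_subset_Icc_self ht)] at hlt
  exact hlt.false

end QuadLagrangian

section Existence

variable {E : Type*} [NormedAddCommGroup E] [NormedSpace ℝ E]

theorem isInvertible_of_pos [FiniteDimensional ℝ E] {B : E →L[ℝ] E →L[ℝ] ℝ}
    (hB : ∀ v ≠ 0, 0 < B v v) : B.IsInvertible := by
  have hinj : Function.Injective B := (injective_iff_map_eq_zero B).2 fun v hv => by
    by_contra hne
    simpa [hv] using hB v hne
  have hdim : Module.finrank ℝ E = Module.finrank ℝ (E →L[ℝ] ℝ) :=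
    Subspace.dual_finrank_eq.symm.trans LinearMap.toContinuousLinearMap.finrank_eq
  exact ⟨(LinearEquiv.ofInjectiveOfFinrankEq (B : E →ₗ[ℝ] E →L[ℝ] ℝ) hinj
    hdim).toContinuousLinearEquiv, rfl⟩

theorem eventually_isInvertible {X F : Type*} [TopologicalSpace X] [NormedAddCommGroup F]
    [NormedSpace ℝ F] [CompleteSpace E] {B : X → E →L[ℝ] F} {x₀ : X} (hB : ContinuousAt B x₀)
    (h₀ : (B x₀).IsInvertible) : ∀ᶠ x in 𝓝 x₀, (B x).IsInvertible := by
  obtain ⟨e, he⟩ := h₀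
  exact hB.eventually (he ▸ ContinuousLinearEquiv.nhds e)

theorem exists_hasDerivAt_of_contDiffAt [CompleteSpace E] {f : E → E} {z₀ : E}
    (hf : ContDiffAt ℝ 1 f z₀) :
    ∃ α : ℝ → E, α 0 = z₀ ∧ ∀ᶠ t in 𝓝 0, HasDerivAt α (f (α t)) t := by
  obtain ⟨α, hα₀, ε, hε, hα⟩ :=
    hf.exists_forall_mem_closedBall_exists_eq_forall_mem_Ioo_hasDerivAt₀ 0
  exact ⟨α, hα₀, eventually_of_mem (Ioo_mem_nhds (by linarith) (by linarith)) hα⟩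

theorem contDiffAt_flip {X F G : Type*} [NormedAddCommGroup X] [NormedSpace ℝ X]
    [NormedAddCommGroup F] [NormedSpace ℝ F] [NormedAddCommGroup G] [NormedSpace ℝ G]
    {n : WithTop ℕ∞} {f : X → E →L[ℝ] F →L[ℝ] G} {x : X} (hf : ContDiffAt ℝ n f x) :
    ContDiffAt ℝ n (fun y => (f y).flip) x :=
  (ContinuousLinearMap.flipₗᵢ ℝ E F G).contDiff.contDiffAt.comp x hf

namespace QuadLagrangian

theorem contDiffAt_posDeriv {X : Type*} [NormedAddCommGroup X] [NormedSpace ℝ X]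
    {L : QuadLagrangian E} {y v : X → E} {z₀ : X} (hquad : ContDiffAt ℝ 2 L.quad (y z₀))
    (hlin : ContDiffAt ℝ 2 L.lin (y z₀)) (hconst : ContDiffAt ℝ 2 L.const (y z₀))
    (hy : ContDiffAt ℝ 1 y z₀) (hv : ContDiffAt ℝ 1 v z₀) :
    ContDiffAt ℝ 1 (fun z => L.posDeriv (y z) (v z)) z₀ := by
  have hquad' := (hquad.fderiv_right (m := 1) (by norm_num)).comp z₀ hy
  have hlin' := (hlin.fderiv_right (m := 1) (by norm_num)).comp z₀ hy
  have hconst' := (hconst.fderiv_right (m := 1) (by norm_num)).comp z₀ hy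
  exact ((contDiffAt_flip ((contDiffAt_flip hquad').clm_apply hv)).clm_apply hv).add
    ((contDiffAt_flip hlin').clm_apply hv) |>.add hconst'

/-- The Lagrangian `|v - w|² - σ²`, where the norm is that of the metric `g`. It vanishes exactly
at the velocities of a ship of own speed `σ` in the wind `w`. -/
noncomputable def navigation (g : E → E →L[ℝ] E →L[ℝ] ℝ) (w : E → E) (σ : E → ℝ) :
    QuadLagrangian E where
  quad := g
  lin y := (-2 : ℝ) • g y (w y)
  const y := g y (w y) (w y) - σ y ^ 2

variable {g : E → E →L[ℝ] E →L[ℝ] ℝ} {w : E → E} {σ : E → ℝ} {y₀ : E}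

theorem navigation_eval {y : E} (hsymm : ∀ v w, g y v w = g y w v) (v : E) :
    (navigation g w σ).eval y v = g y (v - w y) (v - w y) - σ y ^ 2 := by
  simp only [eval, navigation, map_sub, sub_apply, smul_apply, smul_eq_mul, hsymm v (w y)]
  ring

theorem navigation_velDeriv (y v : E) :
    (navigation g w σ).velDeriv y v = (2 : ℝ) • g y (v - w y) := by
  simp only [velDeriv, navigation, map_sub]
  module

theorem isRegularAt_navigation (hg : ContDiffAt ℝ 2 g y₀) (hw : ContDiffAt ℝ 2 w y₀)
    (hσ : ContDiffAt ℝ 2 σ y₀) (hsymm : ∀ᶠ y in 𝓝 y₀, ∀ v w, g y v w = g y w v)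
    (hpos : ∀ v ≠ 0, 0 < g y₀ v v) : (navigation g w σ).IsRegularAt y₀ where
  contDiffAt_quad := hg
  contDiffAt_lin := (hg.clm_apply hw).const_smul (-2 : ℝ)
  contDiffAt_const := ((hg.clm_apply hw).clm_apply hw).sub (hσ.pow 2)
  symm := hsymm
  pos := hpos

end QuadLagrangian

/-- The Lagrange multiplier `μ` of an extremal of the navigation problem, as a function of its
momentum `p = 2 μ B(u, ·)`, where `u` is the velocity relative to the medium, `B` the metric and
`s` the own speed: it is determined by `B(u, u) = s²`. -/
noncomputable def multiplier (B : E →L[ℝ] E →L[ℝ] ℝ) (s : ℝ) (p : E →L[ℝ] ℝ) : ℝ :=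
  √(p (B.inverse p)) / (2 * s)

/-- The velocity `u` relative to the medium, as a function of the momentum `p = 2 μ B(u, ·)`. -/
noncomputable def ownVelocity (B : E →L[ℝ] E →L[ℝ] ℝ) (s : ℝ) (p : E →L[ℝ] ℝ) : E :=
  (2 * multiplier B s p)⁻¹ • B.inverse p

variable {B : E →L[ℝ] E →L[ℝ] ℝ} {s : ℝ} {p : E →L[ℝ] ℝ}

theorem smul_apply_ownVelocity (hB : B.IsInvertible) (hμ : multiplier B s p ≠ 0) :
    multiplier B s p • (2 : ℝ) • B (ownVelocity B s p) = p := by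
  have hcancel : multiplier B s p * (2 * (2 * multiplier B s p)⁻¹) = 1 := by field_simp
  rw [ownVelocity, map_smul, hB.self_apply_inverse, smul_smul, smul_smul, mul_assoc, hcancel,
    one_smul]

theorem apply_ownVelocity_self (hB : B.IsInvertible) (hμ : multiplier B s p ≠ 0) :
    B (ownVelocity B s p) (ownVelocity B s p) = s ^ 2 := by
  have hs : s ≠ 0 := by
    rintro rfl
    simp [multiplier] at hμ
  have hsqrt : √(p (B.inverse p)) = 2 * multiplier B s p * s := by
    rw [multiplier]
    field_simp
  have hq : p (B.inverse p) = (2 * multiplier B s p * s) ^ 2 := by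
    rw [← hsqrt, Real.sq_sqrt]
    exact (Real.sqrt_ne_zero'.1 (by rw [hsqrt]; positivity)).le
  simp only [ownVelocity, map_smul, smul_apply, hB.self_apply_inverse, smul_eq_mul, hq]
  field_simp

theorem multiplier_two_smul (hB : B.IsInvertible) (hs : 0 < s) {u : E} (hu : B u u = s ^ 2) :
    multiplier B s ((2 : ℝ) • B u) = 1 := by
  have hq : ((2 : ℝ) • B u) (B.inverse ((2 : ℝ) • B u)) = (2 * s) ^ 2 := by
    simp only [map_smul, hB.inverse_apply_self, smul_apply, hu, smul_eq_mul]
    ring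
  rw [multiplier, hq, Real.sqrt_sq (by positivity), div_self (by positivity)]

theorem ownVelocity_two_smul (hB : B.IsInvertible) (hs : 0 < s) {u : E} (hu : B u u = s ^ 2) :
    ownVelocity B s ((2 : ℝ) • B u) = u := by
  rw [ownVelocity, multiplier_two_smul hB hs hu, map_smul, hB.inverse_apply_self, smul_smul]
  norm_num

section Smooth

variable [CompleteSpace E] {X : Type*} [NormedAddCommGroup X] [NormedSpace ℝ X]
  {B : X → E →L[ℝ] E →L[ℝ] ℝ} {s : X → ℝ} {p : X → E →L[ℝ] ℝ} {z₀ : X} {n : WithTop ℕ∞}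

theorem contDiffAt_inverse_apply (hB : ContDiffAt ℝ n B z₀) (hp : ContDiffAt ℝ n p z₀)
    (hinv : (B z₀).IsInvertible) : ContDiffAt ℝ n (fun z => (B z).inverse (p z)) z₀ :=
  (hinv.contDiffAt_map_inverse.comp z₀ hB).clm_apply hp

theorem contDiffAt_multiplier (hB : ContDiffAt ℝ n B z₀) (hs : ContDiffAt ℝ n s z₀)
    (hp : ContDiffAt ℝ n p z₀) (hinv : (B z₀).IsInvertible)
    (hμ : multiplier (B z₀) (s z₀) (p z₀) ≠ 0) :
    ContDiffAt ℝ n (fun z => multiplier (B z) (s z) (p z)) z₀ := by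
  obtain ⟨hq, hs₀⟩ := div_ne_zero_iff.1 hμ
  exact ((hp.clm_apply (contDiffAt_inverse_apply hB hp hinv)).sqrt
    (Real.sqrt_ne_zero'.1 hq).ne').div (contDiffAt_const.mul hs) hs₀

theorem contDiffAt_ownVelocity (hB : ContDiffAt ℝ n B z₀) (hs : ContDiffAt ℝ n s z₀)
    (hp : ContDiffAt ℝ n p z₀) (hinv : (B z₀).IsInvertible)
    (hμ : multiplier (B z₀) (s z₀) (p z₀) ≠ 0) :
    ContDiffAt ℝ n (fun z => ownVelocity (B z) (s z) (p z)) z₀ :=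
  ((contDiffAt_const.mul (contDiffAt_multiplier hB hs hp hinv hμ)).inv (by simpa using hμ)).smul
    (contDiffAt_inverse_apply hB hp hinv)

end Smooth

namespace QuadLagrangian

variable {g : E → E →L[ℝ] E →L[ℝ] ℝ} {w : E → E} {σ : E → ℝ} {y₀ : E}

/-- The Lagrange multiplier of the extremal of the navigation problem that has position `z.1` and
momentum `z.2`. -/
noncomputable def navigationMultiplier (g : E → E →L[ℝ] E →L[ℝ] ℝ) (σ : E → ℝ)
    (z : E × (E →L[ℝ] ℝ)) : ℝ :=
  multiplier (g z.1) (σ z.1) z.2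

/-- The velocity of the extremal of the navigation problem that has position `z.1` and momentum
`z.2`. -/
noncomputable def navigationVelocity (g : E → E →L[ℝ] E →L[ℝ] ℝ) (w : E → E) (σ : E → ℝ)
    (z : E × (E →L[ℝ] ℝ)) : E :=
  ownVelocity (g z.1) (σ z.1) z.2 + w z.1

/-- The vector field on phase space given by Hamilton's equations of the navigation problem. -/
noncomputable def hamiltonField (g : E → E →L[ℝ] E →L[ℝ] ℝ) (w : E → E) (σ : E → ℝ)
    (z : E × (E →L[ℝ] ℝ)) : E × (E →L[ℝ] ℝ) :=
  (navigationVelocity g w σ z, navigationMultiplier g σ z •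
    (navigation g w σ).posDeriv z.1 (navigationVelocity g w σ z))

variable {z : E × (E →L[ℝ] ℝ)}

theorem navigationMultiplier_smul_velDeriv (hinv : (g z.1).IsInvertible)
    (hμ : navigationMultiplier g σ z ≠ 0) :
    navigationMultiplier g σ z •
      (navigation g w σ).velDeriv z.1 (navigationVelocity g w σ z) = z.2 := by
  rw [navigation_velDeriv, navigationVelocity, add_sub_cancel_right]
  exact smul_apply_ownVelocity hinv hμ

theorem navigation_eval_navigationVelocity (hsymm : ∀ v w, g z.1 v w = g z.1 w v)
    (hinv : (g z.1).IsInvertible) (hμ : navigationMultiplier g σ z ≠ 0) :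
    (navigation g w σ).eval z.1 (navigationVelocity g w σ z) = 0 := by
  rw [navigation_eval hsymm, navigationVelocity, add_sub_cancel_right]
  exact sub_eq_zero.2 (apply_ownVelocity_self hinv hμ)

theorem isExtremalAt_of_hasDerivAt_hamiltonField {α : ℝ → E × (E →L[ℝ] ℝ)} {t : ℝ}
    (hα : HasDerivAt α (hamiltonField g w σ (α t)) t)
    (hp : ∀ᶠ r in 𝓝 t, (g (α r).1).IsInvertible ∧ navigationMultiplier g σ (α r) ≠ 0) :
    (navigation g w σ).IsExtremalAt (fun r => navigationMultiplier g σ (α r)) (fun r => (α r).1)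
      (fun r => navigationVelocity g w σ (α r)) t := by
  have hmom : HasDerivAt (fun r => (α r).2) _ t := hα.snd
  exact ⟨hα.fst, hmom.congr_of_eventuallyEq
    (hp.mono fun r hr => navigationMultiplier_smul_velDeriv hr.1 hr.2)⟩

section Smooth

variable [CompleteSpace E] {n : WithTop ℕ∞}

theorem contDiffAt_navigationMultiplier (hg : ContDiffAt ℝ n g z.1) (hσ : ContDiffAt ℝ n σ z.1)
    (hinv : (g z.1).IsInvertible) (hμ : navigationMultiplier g σ z ≠ 0) :
    ContDiffAt ℝ n (navigationMultiplier g σ) z :=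
  contDiffAt_multiplier (ContDiffAt.comp z hg contDiffAt_fst)
    (ContDiffAt.comp z hσ contDiffAt_fst) contDiffAt_snd hinv hμ

theorem contDiffAt_navigationVelocity (hg : ContDiffAt ℝ n g z.1) (hw : ContDiffAt ℝ n w z.1)
    (hσ : ContDiffAt ℝ n σ z.1) (hinv : (g z.1).IsInvertible)
    (hμ : navigationMultiplier g σ z ≠ 0) : ContDiffAt ℝ n (navigationVelocity g w σ) z :=
  (contDiffAt_ownVelocity (ContDiffAt.comp z hg contDiffAt_fst)
    (ContDiffAt.comp z hσ contDiffAt_fst) contDiffAt_snd hinv hμ).add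
    (ContDiffAt.comp z hw contDiffAt_fst)

theorem contDiffAt_hamiltonField (hg : ContDiffAt ℝ 2 g z.1) (hw : ContDiffAt ℝ 2 w z.1)
    (hσ : ContDiffAt ℝ 2 σ z.1) (hinv : (g z.1).IsInvertible)
    (hμ : navigationMultiplier g σ z ≠ 0) : ContDiffAt ℝ 1 (hamiltonField g w σ) z := by
  have hvel := (contDiffAt_navigationVelocity hg hw hσ hinv hμ).of_le one_le_two
  exact hvel.prodMk <|
    ((contDiffAt_navigationMultiplier hg hσ hinv hμ).of_le one_le_two).smul <|
    contDiffAt_posDeriv hg ((hg.clm_apply hw).const_smul (-2 : ℝ))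
      (((hg.clm_apply hw).clm_apply hw).sub (hσ.pow 2)) contDiffAt_fst hvel

end Smooth

theorem exists_isExtremalAt_navigation [FiniteDimensional ℝ E] (hg : ContDiffAt ℝ 2 g y₀)
    (hw : ContDiffAt ℝ 2 w y₀) (hσ : ContDiffAt ℝ 2 σ y₀)
    (hsymm : ∀ᶠ y in 𝓝 y₀, ∀ v w, g y v w = g y w v) (hpos : ∀ v ≠ 0, 0 < g y₀ v v)
    (hσ₀ : 0 < σ y₀) {u₀ : E} (hu₀ : g y₀ u₀ u₀ = σ y₀ ^ 2) :
    ∃ (x v : ℝ → E) (μ : ℝ → ℝ), x 0 = y₀ ∧ v 0 = u₀ + w y₀ ∧ 0 < μ 0 ∧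
      ∀ᶠ t in 𝓝 0, (navigation g w σ).IsExtremalAt μ x v t ∧
        (navigation g w σ).eval (x t) (v t) = 0 ∧ ContinuousAt v t ∧ ContinuousAt μ t := by
  have := FiniteDimensional.complete ℝ E
  have hinv := isInvertible_of_pos hpos
  let z₀ : E × (E →L[ℝ] ℝ) := (y₀, (2 : ℝ) • g y₀ u₀)
  have hμ₀ : navigationMultiplier g σ z₀ = 1 := multiplier_two_smul hinv hσ₀ hu₀
  have hμ₀' : navigationMultiplier g σ z₀ ≠ 0 := hμ₀.trans_ne one_ne_zero
  have hμ := contDiffAt_navigationMultiplier (z := z₀) hg hσ hinv hμ₀'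
  have hvel := contDiffAt_navigationVelocity (z := z₀) hg hw hσ hinv hμ₀'
  obtain ⟨α, hα₀, hα⟩ :=
    exists_hasDerivAt_of_contDiffAt (contDiffAt_hamiltonField (z := z₀) hg hw hσ hinv hμ₀')
  have hαlim : Tendsto α (𝓝 0) (𝓝 z₀) := hα₀ ▸ hα.self_of_nhds.continuousAt
  have hnondeg : ∀ᶠ t in 𝓝 0, (g (α t).1).IsInvertible ∧ navigationMultiplier g σ (α t) ≠ 0 :=
    hαlim.eventually <| (continuousAt_fst.eventually
      (eventually_isInvertible hg.continuousAt hinv)).and (hμ.continuousAt.eventually_ne hμ₀')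
  refine ⟨fun t => (α t).1, fun t => navigationVelocity g w σ (α t),
    fun t => navigationMultiplier g σ (α t), congrArg Prod.fst hα₀, ?_, by simp [hα₀, hμ₀], ?_⟩
  · simp only [hα₀, navigationVelocity, z₀, ownVelocity_two_smul hinv hσ₀ hu₀]
  filter_upwards [hα, hnondeg.eventually_nhds, hαlim.eventually (hvel.eventually (by simp)),
    hαlim.eventually (hμ.eventually (by simp)),
    hαlim.eventually (continuousAt_fst.eventually hsymm)] with t ht hnondeg hvel hμ hsymm
  obtain ⟨hinv, hne⟩ := hnondeg.self_of_nhds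
  exact ⟨isExtremalAt_of_hasDerivAt_hamiltonField ht hnondeg,
    navigation_eval_navigationVelocity hsymm hinv hne,
    ContinuousAt.comp hvel.continuousAt ht.continuousAt,
    ContinuousAt.comp hμ.continuousAt ht.continuousAt⟩

end QuadLagrangian

end Existence

section Flow

variable {E : Type*} [NormedAddCommGroup E] [NormedSpace ℝ E]

theorem tendsto_of_lipschitzOnWith_closedBall {E F T : Type*} [SeminormedAddCommGroup E]
    [SeminormedAddCommGroup F] [TopologicalSpace T] {α : E → T → F} {z₀ : E} {y₀ : F} {t₀ : T}
    {r : ℝ} {L : ℝ≥0} (hr : 0 < r)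
    (hL : ∀ᶠ t in 𝓝 t₀, LipschitzOnWith L (α · t) (Metric.closedBall z₀ r))
    (hα : Tendsto (α z₀) (𝓝 t₀) (𝓝 y₀)) :
    Tendsto (fun p : E × T => α p.1 p.2) (𝓝 (z₀, t₀)) (𝓝 y₀) := by
  have hlim : Tendsto (fun p : E × T => L * ‖p.1 - z₀‖ + ‖α z₀ p.2 - y₀‖) (𝓝 (z₀, t₀))
      (𝓝 (L * 0 + 0)) :=
    ((tendsto_iff_norm_sub_tendsto_zero.1 continuousAt_fst).const_mul (L : ℝ)).add
      (tendsto_iff_norm_sub_tendsto_zero.1 (hα.comp continuousAt_snd))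
  rw [mul_zero, add_zero] at hlim
  refine tendsto_iff_norm_sub_tendsto_zero.2
    (squeeze_zero' (Eventually.of_forall fun _ => norm_nonneg _) ?_ hlim)
  filter_upwards [prod_mem_nhds (Metric.closedBall_mem_nhds z₀ hr) hL] with p hp
  exact (norm_sub_le_norm_sub_add_norm_sub _ (α z₀ p.2) _).trans
    (add_le_add_left (hp.2.norm_sub_le hp.1 (Metric.mem_closedBall_self hr.le)) _)

theorem exists_lipschitz_flow [CompleteSpace E] {f : E → E} {z₀ : E} (hf : ContDiffAt ℝ 1 f z₀)
    {N : Set E} (hN : N ∈ 𝓝 z₀) :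
    ∃ r > (0 : ℝ), ∃ ε > (0 : ℝ), ∃ (L : ℝ≥0) (α : E → ℝ → E), ∀ z ∈ Metric.closedBall z₀ r,
      α z 0 = z ∧ ∀ t ∈ Icc (-ε) ε, HasDerivAt (α z) (f (α z t)) t ∧ α z t ∈ N ∧
        ∀ z' ∈ Metric.closedBall z₀ r, ‖α z t - α z' t‖ ≤ L * ‖z - z'‖ := by
  obtain ⟨ε, hε, a, r, _, _, hr, hpl⟩ := IsPicardLindelof.of_contDiffAt_one hf
  obtain ⟨α, hα, L, hLip⟩ :=
    (hpl 0).exists_forall_mem_closedBall_eq_hasDerivWithinAt_lipschitzOnWith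
  simp only [zero_sub, zero_add] at hα hLip
  have hr' : (0 : ℝ) < r := hr
  have hz₀ : z₀ ∈ Metric.closedBall z₀ (r : ℝ) := Metric.mem_closedBall_self r.2
  have hderiv : ∀ z ∈ Metric.closedBall z₀ (r : ℝ), ∀ t ∈ Ioo (-ε) ε,
      HasDerivAt (α z) (f (α z t)) t := fun z hz t ht =>
    ((hα z hz).2 t (Ioo_subset_Icc_self ht)).hasDerivAt (Icc_mem_nhds ht.1 ht.2)
  have hstay : ∀ᶠ p in 𝓝 ((z₀, 0) : E × ℝ), α p.1 p.2 ∈ N := by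
    refine (tendsto_of_lipschitzOnWith_closedBall hr' (eventually_of_mem
      (Icc_mem_nhds (neg_lt_zero.2 hε) hε) hLip) ?_).eventually_mem hN
    simpa only [ContinuousAt, (hα z₀ hz₀).1] using
      (hderiv z₀ hz₀ 0 (by simpa using hε)).continuousAt
  obtain ⟨δ, hδ, hball⟩ := Metric.eventually_nhds_iff_ball.1 hstay
  have hsub : Metric.closedBall z₀ (min (r : ℝ) (δ / 2)) ⊆ Metric.closedBall z₀ (r : ℝ) :=
    Metric.closedBall_subset_closedBall (min_le_left _ _)
  refine ⟨min r (δ / 2), by positivity, min (ε / 2) (δ / 2), by positivity, L, α,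
    fun z hz => ⟨(hα z (hsub hz)).1, fun t ht => ?_⟩⟩
  obtain ⟨-, hzδ⟩ := le_min_iff.1 (mem_closedBall_iff_norm.1 hz)
  obtain ⟨htε, htδ⟩ := le_min_iff.1 (abs_le.2 ht)
  have ht' : t ∈ Ioo (-ε) ε := abs_lt.1 (by linarith)
  refine ⟨hderiv z (hsub hz) t ht', hball (z, t) ?_, fun z' hz' =>
    (hLip t (Ioo_subset_Icc_self ht')).norm_sub_le (hsub hz) (hsub hz')⟩
  rw [mem_ball_iff_norm, Prod.norm_def, max_lt_iff]
  constructor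
  · simp only [Prod.fst_sub]
    linarith
  · simp only [Prod.snd_sub, sub_zero, Real.norm_eq_abs]
    linarith

theorem norm_sub_sub_smul_le {x v a : ℝ → E} {τ C : ℝ} (hτ : 0 ≤ τ)
    (hx : ∀ t ∈ Icc 0 τ, HasDerivAt x (v t) t) (hv : ∀ t ∈ Icc 0 τ, HasDerivAt v (a t) t)
    (ha : ∀ t ∈ Icc 0 τ, ‖a t‖ ≤ C) : ‖x τ - x 0 - τ • v 0‖ ≤ C * τ * τ := by
  have hC : 0 ≤ C := (norm_nonneg _).trans (ha 0 (left_mem_Icc.2 hτ))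
  have hvel : ∀ t ∈ Icc 0 τ, ‖v t - v 0‖ ≤ C * τ := fun t ht => by
    refine ((convex_Icc 0 τ).norm_image_sub_le_of_norm_hasDerivWithin_le
      (fun r hr => (hv r hr).hasDerivWithinAt) ha (left_mem_Icc.2 hτ) ht).trans ?_
    rw [sub_zero, Real.norm_of_nonneg ht.1]
    exact mul_le_mul_of_nonneg_left ht.2 hC
  have hpos := (convex_Icc 0 τ).norm_image_sub_le_of_norm_hasDerivWithin_le
    (fun r hr => ((hx r hr).sub ((hasDerivAt_id r).smul_const (v 0))).hasDerivWithinAt)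
    (fun r hr => by simpa using hvel r hr) (left_mem_Icc.2 hτ) (right_mem_Icc.2 hτ)
  simpa [abs_of_nonneg hτ, sub_right_comm] using hpos

theorem surjOn_closedBall_of_norm_sub_smul_le [CompleteSpace E] {f : E → E} {τ e : ℝ}
    (hτ : 0 < τ) (he : 0 ≤ e)
    (hf : ∀ u ∈ Metric.closedBall 0 e, ∀ u' ∈ Metric.closedBall 0 e,
      ‖f u - f u' - τ • (u - u')‖ ≤ τ / 2 * ‖u - u'‖) :
    SurjOn f (Metric.closedBall 0 e) (Metric.closedBall (f 0) (τ / 2 * e)) := by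
  lift τ to ℝ≥0 using hτ.le
  have hτ' : (τ : ℝ) ≠ 0 := hτ.ne'
  have happrox : ApproximatesLinearOn f ((τ : ℝ) • ContinuousLinearMap.id ℝ E)
      (Metric.closedBall 0 e) (τ / 2) := fun u hu u' hu' => by
    simpa using hf u hu u' hu'
  let inv : ContinuousLinearMap.NonlinearRightInverse ((τ : ℝ) • ContinuousLinearMap.id ℝ E) :=
    { toFun := fun y => (τ : ℝ)⁻¹ • y
      nnnorm := τ⁻¹
      bound' := fun y => by simp [norm_smul]
      right_inv' := fun y => by simp [smul_smul, hτ'] }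
  convert happrox.surjOn_closedBall_of_nonlinearRightInverse inv he Subset.rfl using 2
  simp only [inv, NNReal.coe_inv, inv_inv, NNReal.coe_div, NNReal.coe_ofNat]
  ring

end Flow

section Geodesics

variable {E : Type*} [NormedAddCommGroup E] [NormedSpace ℝ E]
  {g : E → E →L[ℝ] E →L[ℝ] ℝ} {y₀ : E} {x v : ℝ → E} {t : ℝ}

namespace QuadLagrangian

/-- The Lagrangian `|v|²` of the metric `g`, whose extremals are the geodesics. -/
noncomputable def energy (g : E → E →L[ℝ] E →L[ℝ] ℝ) : QuadLagrangian E := ⟨g, 0, 0⟩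

theorem energy_velDeriv (y v : E) : (energy g).velDeriv y v = (2 : ℝ) • g y v := by
  simp [energy, velDeriv]

theorem energy_posDeriv_apply (y v ξ : E) :
    (energy g).posDeriv y v ξ = fderiv ℝ g y ξ v v := by
  rw [posDeriv_apply, energy, fderiv_zero, fderiv_zero]
  simp

end QuadLagrangian

open QuadLagrangian

/-- The field `g` of bilinear forms is differentiable at `y`, where it is symmetric and positive
definite. -/
structure IsMetricAt (g : E → E →L[ℝ] E →L[ℝ] ℝ) (y : E) : Prop where
  differentiableAt : DifferentiableAt ℝ g y
  symm : ∀ v w, g y v w = g y w v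
  pos : ∀ v ≠ 0, 0 < g y v v

theorem eventually_isMetricAt [FiniteDimensional ℝ E] (hg : ContDiffAt ℝ 2 g y₀)
    (hsymm : ∀ᶠ y in 𝓝 y₀, ∀ v w, g y v w = g y w v) (hpos : ∀ v ≠ 0, 0 < g y₀ v v) :
    ∀ᶠ y in 𝓝 y₀, IsMetricAt g y := by
  obtain ⟨a, ha, hlow⟩ := exists_eventually_mul_norm_sq_le_of_pos hg.continuousAt hpos
  filter_upwards [hg.eventually (by simp), hsymm, hlow] with y hy hsymm hlow
  exact ⟨hy.differentiableAt two_ne_zero, hsymm,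
    fun v hv => (by positivity : 0 < a * ‖v‖ ^ 2).trans_le (hlow v)⟩

/-- The acceleration of the geodesics of the metric `g` on a vector space, as a function of
position and velocity. -/
noncomputable def geodesicAcc (g : E → E →L[ℝ] E →L[ℝ] ℝ) (y v : E) : E :=
  (g y).inverse ((1 / 2 : ℝ) • (energy g).posDeriv y v - fderiv ℝ g y v v)

theorem eq_geodesicAcc_iff [FiniteDimensional ℝ E] {y : E} (hpos : ∀ u ≠ 0, 0 < g y u u)
    (v a : E) : a = geodesicAcc g y v ↔
      ∀ ξ, g y a ξ = 1 / 2 * fderiv ℝ g y ξ v v - fderiv ℝ g y v v ξ := by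
  have hinv := isInvertible_of_pos hpos
  rw [geodesicAcc, ← (hinv.injective).eq_iff, hinv.self_apply_inverse, ContinuousLinearMap.ext_iff]
  simp only [sub_apply, smul_apply, smul_eq_mul, energy_posDeriv_apply]

theorem geodesicAcc_smul (y v : E) (c : ℝ) :
    geodesicAcc g y (c • v) = c ^ 2 • geodesicAcc g y v := by
  rw [geodesicAcc, geodesicAcc, ← map_smul]
  congr 1
  ext ξ
  simp only [sub_apply, smul_apply, energy_posDeriv_apply, map_smul, smul_eq_mul]
  ring

theorem contDiffAt_geodesicAcc [FiniteDimensional ℝ E] (hg : ContDiffAt ℝ 2 g y₀)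
    (hpos : ∀ v ≠ 0, 0 < g y₀ v v) (v₀ : E) :
    ContDiffAt ℝ 1 (fun z : E × E => geodesicAcc g z.1 z.2) (y₀, v₀) := by
  have := FiniteDimensional.complete ℝ E
  have hposDeriv : ContDiffAt ℝ 1 (fun z : E × E => (energy g).posDeriv z.1 z.2) (y₀, v₀) :=
    contDiffAt_posDeriv hg contDiffAt_const contDiffAt_const contDiffAt_fst contDiffAt_snd
  have hfderiv : ContDiffAt ℝ 1 (fun z : E × E => fderiv ℝ g z.1) (y₀, v₀) :=
    ContDiffAt.comp (f := Prod.fst) (g := fderiv ℝ g) (y₀, v₀)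
      (hg.fderiv_right (m := 1) (by norm_num)) contDiffAt_fst
  have hg' : ContDiffAt ℝ 1 (fun z : E × E => g z.1) (y₀, v₀) :=
    ContDiffAt.comp (f := Prod.fst) (y₀, v₀) (hg.of_le one_le_two) contDiffAt_fst
  exact contDiffAt_inverse_apply hg' ((hposDeriv.const_smul (1 / 2 : ℝ)).sub
    ((hfderiv.clm_apply contDiffAt_snd).clm_apply contDiffAt_snd)) (isInvertible_of_pos hpos)

/-- The curve `x` has velocity `v` at time `t` and satisfies there the geodesic equation of the
metric `g` on a vector space, as a first order equation for `x` and `v`. -/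
structure IsGeodesicAt (g : E → E →L[ℝ] E →L[ℝ] ℝ) (x v : ℝ → E) (t : ℝ) : Prop where
  hasDerivAt_pos : HasDerivAt x (v t) t
  hasDerivAt_vel : HasDerivAt v (geodesicAcc g (x t) (v t)) t

namespace IsGeodesicAt

theorem comp {l : ℝ → ℝ} {c : ℝ} (hl : HasDerivAt l c t) (hx : IsGeodesicAt g x v (l t)) :
    IsGeodesicAt g (x ∘ l) (fun r => c • v (l r)) t := by
  refine ⟨hx.hasDerivAt_pos.scomp t hl, ?_⟩
  rw [geodesicAcc_smul, sq, mul_smul]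
  exact (hx.hasDerivAt_vel.scomp t hl).const_smul c

theorem congr_of_eventuallyEq {z : ℝ → E} (hx : IsGeodesicAt g x v t) (hz : z =ᶠ[𝓝 t] x) :
    IsGeodesicAt g z v t :=
  ⟨hx.hasDerivAt_pos.congr_of_eventuallyEq hz, hz.self_of_nhds ▸ hx.hasDerivAt_vel⟩

theorem isExtremalAt [FiniteDimensional ℝ E] (hx : IsGeodesicAt g x v t)
    (hg : IsMetricAt g (x t)) : (energy g).IsExtremalAt (fun _ => 1) x v t := by
  refine ⟨hx.hasDerivAt_pos, ?_⟩
  have hgx : HasDerivAt (fun r => g (x r)) (fderiv ℝ g (x t) (v t)) t :=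
    hg.differentiableAt.hasFDerivAt.comp_hasDerivAt t hx.hasDerivAt_pos
  simp only [energy_velDeriv, one_smul]
  refine ((hgx.clm_apply hx.hasDerivAt_vel).const_smul (2 : ℝ)).congr_deriv ?_
  rw [geodesicAcc, (isInvertible_of_pos hg.pos).self_apply_inverse]
  module

theorem hasDerivAt_speed_sq [FiniteDimensional ℝ E] (hx : IsGeodesicAt g x v t)
    (hg : IsMetricAt g (x t)) : HasDerivAt (fun r => g (x r) (v r) (v r)) 0 t := by
  have hgx : HasDerivAt (fun r => g (x r)) (fderiv ℝ g (x t) (v t)) t :=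
    hg.differentiableAt.hasFDerivAt.comp_hasDerivAt t hx.hasDerivAt_pos
  refine ((hgx.clm_apply hx.hasDerivAt_vel).clm_apply hx.hasDerivAt_vel).congr_deriv ?_
  rw [add_apply, hg.symm (v t), geodesicAcc, (isInvertible_of_pos hg.pos).self_apply_inverse]
  simp only [sub_apply, smul_apply, smul_eq_mul, energy_posDeriv_apply]
  ring

theorem speed_sq_eq [FiniteDimensional ℝ E] {a b : ℝ}
    (hx : ∀ t ∈ Icc a b, IsGeodesicAt g x v t) (hg : ∀ t ∈ Icc a b, IsMetricAt g (x t))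
    (ht : t ∈ Icc a b) : g (x t) (v t) (v t) = g (x a) (v a) (v a) := by
  have hderiv : ∀ r ∈ Icc a b, HasDerivAt (fun r => g (x r) (v r) (v r)) 0 r := fun r hr =>
    (hx r hr).hasDerivAt_speed_sq (hg r hr)
  exact constant_of_has_deriv_right_zero (fun r hr => (hderiv r hr).continuousAt.continuousWithinAt)
    (fun r hr => (hderiv r (Ico_subset_Icc_self hr)).hasDerivWithinAt) t ht

theorem eq_of_vel_eq_zero [FiniteDimensional ℝ E] {a b : ℝ}
    (hx : ∀ t ∈ Icc a b, IsGeodesicAt g x v t) (hg : ∀ t ∈ Icc a b, IsMetricAt g (x t))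
    (hva : v a = 0) (ht : t ∈ Icc a b) : x t = x a := by
  have hv : ∀ r ∈ Icc a b, v r = 0 := fun r hr => by
    by_contra hne
    simpa [speed_sq_eq hx hg hr, hva] using (hg r hr).pos _ hne
  refine constant_of_has_deriv_right_zero
    (fun r hr => (hx r hr).hasDerivAt_pos.continuousAt.continuousWithinAt) (fun r hr => ?_) t ht
  exact hv r (Ico_subset_Icc_self hr) ▸
    (hx r (Ico_subset_Icc_self hr)).hasDerivAt_pos.hasDerivWithinAt

theorem contDiffAt_two [FiniteDimensional ℝ E] (hx : ∀ᶠ r in 𝓝 t, IsGeodesicAt g x v r)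
    (hg : ContDiffAt ℝ 2 g (x t)) (hpos : ∀ u ≠ 0, 0 < g (x t) u u) : ContDiffAt ℝ 2 x t := by
  have hxv : ContDiffAt ℝ 0 (fun r => (x r, v r)) t := contDiffAt_zero.2 ⟨_, hx, fun r hr =>
    (hr.hasDerivAt_pos.continuousAt.prodMk hr.hasDerivAt_vel.continuousAt).continuousWithinAt⟩
  have hacc : ContDiffAt ℝ 0 (fun r => geodesicAcc g (x r) (v r)) t :=
    ContDiffAt.comp (g := fun z : E × E => geodesicAcc g z.1 z.2) t
      ((contDiffAt_geodesicAcc hg hpos (v t)).of_le zero_le_one) hxv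
  have hv : ContDiffAt ℝ 1 v t := by
    simpa using contDiffAt_succ_of_hasDerivAt (n := 0) (hx.mono fun r hr => hr.hasDerivAt_vel) hacc
  exact contDiffAt_succ_of_hasDerivAt (n := 1) (hx.mono fun r hr => hr.hasDerivAt_pos) hv

end IsGeodesicAt

theorem exists_geodesic_flow [FiniteDimensional ℝ E] (hg : ContDiffAt ℝ 2 g y₀)
    (hpos : ∀ v ≠ 0, 0 < g y₀ v v) {N : Set E} (hN : N ∈ 𝓝 y₀) :
    ∃ r > (0 : ℝ), ∃ ε > (0 : ℝ), ∃ C > (0 : ℝ), ∃ x v : E × E → ℝ → E,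
      ∀ z ∈ Metric.closedBall (y₀, (0 : E)) r, x z 0 = z.1 ∧ v z 0 = z.2 ∧
        ∀ t ∈ Icc (-ε) ε, IsGeodesicAt g (x z) (v z) t ∧ x z t ∈ N ∧
          ∀ z' ∈ Metric.closedBall (y₀, (0 : E)) r,
            ‖geodesicAcc g (x z t) (v z t) - geodesicAcc g (x z' t) (v z' t)‖ ≤ C * ‖z - z'‖ := by
  have := FiniteDimensional.complete ℝ E
  have hacc := contDiffAt_geodesicAcc hg hpos 0
  obtain ⟨K, s, hs, hK⟩ := hacc.exists_lipschitzOnWith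
  obtain ⟨r, hr, ε, hε, L, α, hα⟩ := exists_lipschitz_flow (contDiffAt_snd.prodMk hacc)
    (inter_mem hs ((continuous_fst.tendsto (y₀, (0 : E))).eventually_mem hN))
  refine ⟨r, hr, ε, hε, K * L + 1, by positivity, fun z t => (α z t).1, fun z t => (α z t).2,
    fun z hz => ⟨congrArg Prod.fst (hα z hz).1, congrArg Prod.snd (hα z hz).1,
      fun t ht => ?_⟩⟩
  obtain ⟨hderiv, ⟨hzs, hzN⟩, hL⟩ := (hα z hz).2 t ht
  refine ⟨⟨hderiv.fst, hderiv.snd⟩, hzN, fun z' hz' => ?_⟩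
  calc _ ≤ K * ‖α z t - α z' t‖ := hK.norm_sub_le hzs ((hα z' hz').2 t ht).2.1.1
    _ ≤ K * (L * ‖z - z'‖) := by gcongr; exact hL z' hz'
    _ ≤ (K * L + 1) * ‖z - z'‖ := by linarith [norm_nonneg (z - z')]

theorem exists_geodesic_flow_approx_smul [FiniteDimensional ℝ E] (hg : ContDiffAt ℝ 2 g y₀)
    (hpos : ∀ v ≠ 0, 0 < g y₀ v v) {N : Set E} (hN : N ∈ 𝓝 y₀) :
    ∃ τ > (0 : ℝ), ∃ r > (0 : ℝ), ∃ x v : E × E → ℝ → E,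
      ∀ z ∈ Metric.ball y₀ r, ∀ u ∈ Metric.closedBall (0 : E) r,
        x (z, u) 0 = z ∧ v (z, u) 0 = u ∧
        (∀ t ∈ Icc 0 τ, (∀ᶠ r in 𝓝 t, IsGeodesicAt g (x (z, u)) (v (z, u)) r) ∧ x (z, u) t ∈ N) ∧
        ∀ u' ∈ Metric.closedBall (0 : E) r,
          ‖x (z, u) τ - x (z, u') τ - τ • (u - u')‖ ≤ τ / 2 * ‖u - u'‖ := by
  obtain ⟨r, hr, ε, hε, C, hC, x, v, hflow⟩ := exists_geodesic_flow hg hpos hN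
  set τ := min (ε / 2) (1 / (2 * C))
  have hτ₀ : 0 < τ := by positivity
  have hCτ : C * τ ≤ 1 / 2 := by
    calc C * τ ≤ C * (1 / (2 * C)) := by gcongr; exact min_le_right _ _
      _ = 1 / 2 := by field_simp
  have htime : ∀ t ∈ Icc 0 τ, t ∈ Ioo (-ε) ε := fun t ht =>
    ⟨by linarith [ht.1], by linarith [ht.2, min_le_left (ε / 2) (1 / (2 * C))]⟩
  have htime' := fun t ht => Ioo_subset_Icc_self (htime t ht)
  refine ⟨τ, hτ₀, r, hr, x, v, fun z hz u hu => ?_⟩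
  have hmem : ∀ u ∈ Metric.closedBall (0 : E) r, (z, u) ∈ Metric.closedBall (y₀, (0 : E)) r :=
    fun u hu => closedBall_prod_same y₀ (0 : E) r ▸ ⟨Metric.ball_subset_closedBall hz, hu⟩
  obtain ⟨hx, hv, hxv⟩ := hflow _ (hmem u hu)
  refine ⟨hx, hv, fun t ht => ⟨?_, (hxv t (htime' t ht)).2.1⟩, fun u' hu' => ?_⟩
  · filter_upwards [Icc_mem_nhds (htime t ht).1 (htime t ht).2] with r hr
    exact (hxv r hr).1
  obtain ⟨hx', hv', hxv'⟩ := hflow _ (hmem u' hu')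
  have h := norm_sub_sub_smul_le (x := x (z, u) - x (z, u')) (v := v (z, u) - v (z, u')) hτ₀.le
    (fun t ht => (hxv t (htime' t ht)).1.hasDerivAt_pos.sub (hxv' t (htime' t ht)).1.hasDerivAt_pos)
    (fun t ht => (hxv t (htime' t ht)).1.hasDerivAt_vel.sub (hxv' t (htime' t ht)).1.hasDerivAt_vel)
    (fun t ht => (hxv t (htime' t ht)).2.2 _ (hmem u' hu'))
  have hnorm : ‖(z, u) - (z, u')‖ = ‖u - u'‖ := by simp [Prod.norm_def]
  simp only [Pi.sub_apply, hx, hx', hv, hv', sub_self, sub_zero, hnorm] at h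
  calc _ ≤ C * ‖u - u'‖ * τ * τ := h
    _ = C * τ * (τ * ‖u - u'‖) := by ring
    _ ≤ 1 / 2 * (τ * ‖u - u'‖) := by gcongr
    _ = τ / 2 * ‖u - u'‖ := by ring

theorem exists_time_forall_exists_geodesic [FiniteDimensional ℝ E] (hg : ContDiffAt ℝ 2 g y₀)
    (hsymm : ∀ᶠ y in 𝓝 y₀, ∀ v w, g y v w = g y w v) (hpos : ∀ v ≠ 0, 0 < g y₀ v v)
    {N : Set E} (hN : N ∈ 𝓝 y₀) :
    ∃ τ > (0 : ℝ), ∃ ρ > (0 : ℝ), ∀ z₁ ∈ Metric.ball y₀ ρ, ∀ z₂ ∈ Metric.ball y₀ ρ,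
      ∃ x v : ℝ → E, x 0 = z₁ ∧ x τ = z₂ ∧ ‖v 0‖ * τ ≤ 2 * ‖z₂ - z₁‖ ∧
        ∀ t ∈ Icc 0 τ, (∀ᶠ r in 𝓝 t, IsGeodesicAt g x v r) ∧ x t ∈ N := by
  have := FiniteDimensional.complete ℝ E
  obtain ⟨τ, hτ, r, hr, x, v, hflow⟩ := exists_geodesic_flow_approx_smul hg hpos
    (inter_mem hN (eventually_isMetricAt hg hsymm hpos))
  refine ⟨τ, hτ, min r (r * τ / 4), by positivity, fun z₁ h₁ z₂ h₂ => ?_⟩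
  have h₁' := Metric.ball_subset_ball (min_le_left _ _) h₁
  set e := 2 * ‖z₂ - z₁‖ / τ with he
  have her : e ≤ r := by
    rw [mem_ball_iff_norm, lt_min_iff] at h₁ h₂
    rw [he, div_le_iff₀ hτ]
    linarith [norm_sub_le_norm_sub_add_norm_sub z₂ y₀ z₁, norm_sub_rev y₀ z₁]
  have hball := Metric.closedBall_subset_closedBall (x := (0 : E)) her
  have hstay : x (z₁, 0) τ = z₁ := by
    obtain ⟨hx, hv, hxv, -⟩ := hflow z₁ h₁' 0 (Metric.mem_closedBall_self hr.le)
    rw [IsGeodesicAt.eq_of_vel_eq_zero (fun t ht => (hxv t ht).1.self_of_nhds)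
      (fun t ht => (hxv t ht).2.2) hv (right_mem_Icc.2 hτ.le), hx]
  have hsurj := surjOn_closedBall_of_norm_sub_smul_le (f := fun u => x (z₁, u) τ) (e := e) hτ
    (by positivity) fun u hu u' hu' => (hflow z₁ h₁' u (hball hu)).2.2.2 u' (hball hu')
  obtain ⟨u, hu, hxu⟩ : z₂ ∈ (fun u => x (z₁, u) τ) '' Metric.closedBall 0 e := by
    refine hsurj ?_
    rw [hstay, mem_closedBall_iff_norm, he]
    exact le_of_eq (by field_simp)
  obtain ⟨hx, hv, hxv, -⟩ := hflow z₁ h₁' u (hball hu)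
  refine ⟨x (z₁, u), v (z₁, u), hx, hxu, ?_, fun t ht => ⟨(hxv t ht).1, (hxv t ht).2.1⟩⟩
  rw [hv, ← le_div_iff₀ hτ]
  exact mem_closedBall_zero_iff.1 hu

theorem norm_le_sqrt_mul_of_apply_eq {Q Q' : E →L[ℝ] E →L[ℝ] ℝ} {u v : E} {a b : ℝ} (ha : 0 < a)
    (hQ : a * ‖v‖ ^ 2 ≤ Q v v) (hQ' : ‖Q'‖ ≤ b) (h : Q v v = Q' u u) :
    ‖v‖ ≤ √(b / a) * ‖u‖ := by
  have hb : 0 ≤ b := (norm_nonneg Q').trans hQ'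
  have hle : Q' u u ≤ b * ‖u‖ ^ 2 := calc
    Q' u u ≤ ‖Q'‖ * ‖u‖ * ‖u‖ := (le_abs_self _).trans (Q'.le_opNorm₂ u u)
    _ ≤ b * ‖u‖ * ‖u‖ := by gcongr
    _ = b * ‖u‖ ^ 2 := by ring
  refine le_of_sq_le_sq ?_ (by positivity)
  rw [mul_pow, Real.sq_sqrt (by positivity), div_mul_eq_mul_div, le_div_iff₀ ha]
  linarith

theorem exists_geodesic_between [FiniteDimensional ℝ E] (hg : ContDiffAt ℝ 2 g y₀)
    (hsymm : ∀ᶠ y in 𝓝 y₀, ∀ v w, g y v w = g y w v) (hpos : ∀ v ≠ 0, 0 < g y₀ v v) :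
    ∃ Λ : ℝ, 0 ≤ Λ ∧ ∀ N ∈ 𝓝 y₀, ∃ ρ > 0, ∀ z₁ ∈ Metric.ball y₀ ρ, ∀ z₂ ∈ Metric.ball y₀ ρ,
      ∀ t₁ t₂ : ℝ, t₁ < t₂ → ∃ (x v : ℝ → E) (κ : ℝ), x t₁ = z₁ ∧ x t₂ = z₂ ∧
        ∀ t ∈ Icc t₁ t₂, (∀ᶠ r in 𝓝 t, IsGeodesicAt g x v r) ∧ x t ∈ N ∧
          g (x t) (v t) (v t) = κ ∧ ‖v t‖ * (t₂ - t₁) ≤ Λ * ‖z₂ - z₁‖ := by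
  obtain ⟨a, ha, hlow⟩ := exists_eventually_mul_norm_sq_le_of_pos hg.continuousAt hpos
  have hup : ∀ᶠ y in 𝓝 y₀, ‖g y‖ < ‖g y₀‖ + 1 :=
    hg.continuousAt.norm.eventually_lt_const (lt_add_one _)
  refine ⟨√((‖g y₀‖ + 1) / a) * 2, by positivity, fun N hN => ?_⟩
  obtain ⟨τ, hτ, ρ, hρ, hgeo⟩ := exists_time_forall_exists_geodesic hg hsymm hpos
    (inter_mem hN ((eventually_isMetricAt hg hsymm hpos).and (hlow.and hup)))
  refine ⟨ρ, hρ, fun z₁ h₁ z₂ h₂ t₁ t₂ ht₁₂ => ?_⟩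
  obtain ⟨x, v, hx₁, hx₂, hv₀, hxv⟩ := hgeo z₁ h₁ z₂ h₂
  set c := τ / (t₂ - t₁)
  have hT : 0 < t₂ - t₁ := sub_pos.2 ht₁₂
  have hc₀ : 0 < c := by positivity
  have hcT : c * (t₂ - t₁) = τ := div_mul_cancel₀ _ hT.ne'
  have htime : ∀ t ∈ Icc t₁ t₂, c * (t - t₁) ∈ Icc 0 τ := fun t ht =>
    ⟨mul_nonneg hc₀.le (sub_nonneg.2 ht.1), hcT ▸ by gcongr; exact ht.2⟩
  have hspeed : ∀ r ∈ Icc 0 τ, g (x r) (v r) (v r) = g (x 0) (v 0) (v 0) := fun r hr =>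
    IsGeodesicAt.speed_sq_eq (fun r hr => (hxv r hr).1.self_of_nhds)
      (fun r hr => (hxv r hr).2.2.1) hr
  have hlin : ∀ r, HasDerivAt (fun r => c * (r - t₁)) c r := fun r => by
    simpa using ((hasDerivAt_id r).sub_const t₁).const_mul c
  refine ⟨fun t => x (c * (t - t₁)), fun t => c • v (c * (t - t₁)),
    c ^ 2 * g (x 0) (v 0) (v 0), by simpa using hx₁, by simpa only [hcT] using hx₂,
    fun t ht => ⟨?_, (hxv _ (htime t ht)).2.1, ?_, ?_⟩⟩
  · filter_upwards [(hlin t).continuousAt.eventually (hxv _ (htime t ht)).1] with r hr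
    exact hr.comp (hlin r)
  · rw [← hspeed _ (htime t ht)]
    simp only [map_smul, smul_apply, smul_eq_mul]
    ring
  · have hvel : ‖v (c * (t - t₁))‖ ≤ √((‖g y₀‖ + 1) / a) * ‖v 0‖ :=
      norm_le_sqrt_mul_of_apply_eq ha ((hxv _ (htime t ht)).2.2.2.1 _)
        (hxv 0 (left_mem_Icc.2 hτ.le)).2.2.2.2.le (hspeed _ (htime t ht))
    calc ‖c • v (c * (t - t₁))‖ * (t₂ - t₁)
        = ‖v (c * (t - t₁))‖ * (c * (t₂ - t₁)) := by
          rw [norm_smul, Real.norm_of_nonneg hc₀.le]; ring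
      _ ≤ √((‖g y₀‖ + 1) / a) * ‖v 0‖ * τ := by rw [hcT]; gcongr
      _ = √((‖g y₀‖ + 1) / a) * (‖v 0‖ * τ) := by ring
      _ ≤ √((‖g y₀‖ + 1) / a) * (2 * ‖z₂ - z₁‖) := by gcongr
      _ = √((‖g y₀‖ + 1) / a) * 2 * ‖z₂ - z₁‖ := by ring

end Geodesics

section Slowdown

variable {E : Type*} [NormedAddCommGroup E] [NormedSpace ℝ E]

namespace QuadLagrangian

theorem exists_norm_le_of_navigation_eval_eq_zero [FiniteDimensional ℝ E]
    {g : E → E →L[ℝ] E →L[ℝ] ℝ} {w : E → E} {σ : E → ℝ} {y₀ : E} (hg : ContinuousAt g y₀)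
    (hw : ContinuousAt w y₀) (hσ : ContinuousAt σ y₀)
    (hsymm : ∀ᶠ y in 𝓝 y₀, ∀ v w, g y v w = g y w v) (hpos : ∀ v ≠ 0, 0 < g y₀ v v) :
    ∃ C > 0, ∀ᶠ y in 𝓝 y₀, ∀ v, (navigation g w σ).eval y v = 0 → ‖v‖ ≤ C := by
  obtain ⟨a, ha, hlow⟩ := exists_eventually_mul_norm_sq_le_of_pos hg hpos
  refine ⟨√((σ y₀ ^ 2 + 1) / a) + (‖w y₀‖ + 1), by positivity, ?_⟩
  filter_upwards [hlow, hsymm, hw.norm.eventually_lt_const (lt_add_one _),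
    (hσ.pow 2).eventually_lt_const (lt_add_one _)] with y hlow hsymm hw hσ v hv
  simp only [Pi.pow_apply] at hσ
  rw [navigation_eval hsymm, sub_eq_zero] at hv
  have hown : ‖v - w y‖ ≤ √((σ y₀ ^ 2 + 1) / a) := by
    refine Real.le_sqrt_of_sq_le ?_
    rw [le_div_iff₀ ha]
    linarith [hlow (v - w y)]
  linarith [norm_le_norm_sub_add v (w y)]

theorem eval_smul_neg {L : QuadLagrangian E} {y v : E} {c : ℝ} (hquad : 0 ≤ L.quad y v v)
    (hconst : L.const y < 0) (hv : L.eval y v = 0) (hc : 0 ≤ c) (hc₁ : c < 1) :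
    L.eval y (c • v) < 0 := by
  have heval : L.eval y (c • v) =
      c * L.eval y v - c * (1 - c) * L.quad y v v + (1 - c) * L.const y := by
    simp only [eval, map_smul, smul_apply, smul_eq_mul]
    ring
  have hc' : 0 < 1 - c := sub_pos.2 hc₁
  rw [heval, hv]
  linarith [mul_nonneg (mul_nonneg hc hc'.le) hquad, mul_neg_of_pos_of_neg hc' hconst]

theorem exists_reparam_eval_neg {L : QuadLagrangian E} {z u : ℝ → E} {T t₁ t₂ : ℝ} {S : Finset ℝ}
    (hT : 0 ≤ T) (hlt : T < t₂ - t₁) (hz : ContinuousOn z (Icc 0 T))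
    (hzu : ∀ t ∈ Ioo 0 T, t ∉ S → HasDerivAt z (u t) t ∧ L.eval (z t) (u t) = 0)
    (hquad : ∀ t ∈ Icc 0 T, ∀ v, 0 ≤ L.quad (z t) v v)
    (hconst : ∀ t ∈ Icc 0 T, L.const (z t) < 0) :
    ∃ (z' u' : ℝ → E) (S' : Finset ℝ), z' t₁ = z 0 ∧ z' t₂ = z T ∧ ContinuousOn z' (Icc t₁ t₂) ∧
      MapsTo z' (Icc t₁ t₂) (z '' Icc 0 T) ∧
      ∀ t ∈ Ioo t₁ t₂, t ∉ S' → HasDerivAt z' (u' t) t ∧ L.eval (z' t) (u' t) < 0 := by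
  set c := T / (t₂ - t₁)
  have hlen : 0 < t₂ - t₁ := hT.trans_lt hlt
  have hc₀ : 0 ≤ c := by positivity
  have hc₁ : c < 1 := (div_lt_one hlen).2 hlt
  have hcT : c * (t₂ - t₁) = T := div_mul_cancel₀ _ hlen.ne'
  have hmaps : MapsTo (fun t => c * (t - t₁)) (Icc t₁ t₂) (Icc 0 T) := fun t ht =>
    ⟨mul_nonneg hc₀ (sub_nonneg.2 ht.1),
      (mul_le_mul_of_nonneg_left (sub_le_sub_right ht.2 t₁) hc₀).trans_eq hcT⟩
  have hlin : ∀ t, HasDerivAt (fun r => c * (r - t₁)) c t := fun t => by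
    simpa using ((hasDerivAt_id t).sub_const t₁).const_mul c
  refine ⟨fun t => z (c * (t - t₁)), fun t => c • u (c * (t - t₁)), S.image fun q => t₁ + q / c,
    by simp, by simp [hcT], hz.comp (by fun_prop) hmaps, fun t ht => mem_image_of_mem z (hmaps ht),
    fun t ht htS => ?_⟩
  have ht' := hmaps (Ioo_subset_Icc_self ht)
  rcases hc₀.eq_or_lt with hc₀ | hc₀
  · simp only [← hc₀, zero_mul, zero_smul] at ht' ⊢
    exact ⟨hasDerivAt_const t _, by simpa [eval] using hconst 0 ht'⟩
  · have hq : c * (t - t₁) ∈ Ioo 0 T :=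
      ⟨mul_pos hc₀ (sub_pos.2 ht.1),
        (mul_lt_mul_of_pos_left (sub_lt_sub_right ht.2 t₁) hc₀).trans_eq hcT⟩
    have hqS : c * (t - t₁) ∉ S := fun hmem =>
      htS (Finset.mem_image.2 ⟨_, hmem, by field_simp; ring⟩)
    obtain ⟨hderiv, heval⟩ := hzu _ hq hqS
    exact ⟨hderiv.scomp t (hlin t), eval_smul_neg (hquad _ ht' _) (hconst _ ht') heval hc₀.le hc₁⟩

end QuadLagrangian

end Slowdown

section Charts

variable {E : Type*} [NormedAddCommGroup E] [NormedSpace ℝ E]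
  {M : Type*} [TopologicalSpace M] [ChartedSpace E M]

/-- The derivative of a chart, with values in the model space instead of its tangent spaces. -/
noncomputable def chartDeriv (φ : OpenPartialHomeomorph M E) (x : M) :
    TangentSpace 𝓘(ℝ, E) x →L[ℝ] E :=
  mfderiv 𝓘(ℝ, E) 𝓘(ℝ, E) φ x

/-- The derivative of the inverse of a chart, defined on the model space instead of its tangent
spaces. -/
noncomputable def chartSymmDeriv (φ : OpenPartialHomeomorph M E) (y : E) :
    E →L[ℝ] TangentSpace 𝓘(ℝ, E) (φ.symm y) :=
  mfderiv 𝓘(ℝ, E) 𝓘(ℝ, E) φ.symm y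

/-- The coordinate expression of the vector field `W` in the chart `φ`. -/
noncomputable def chartField (W : ∀ x : M, TangentSpace 𝓘(ℝ, E) x)
    (φ : OpenPartialHomeomorph M E) (y : E) : E :=
  chartDeriv φ (φ.symm y) (W (φ.symm y))

theorem chartField_apply {φ : OpenPartialHomeomorph M E} (W : ∀ x : M, TangentSpace 𝓘(ℝ, E) x)
    {x : M} (hx : x ∈ φ.source) : chartField W φ (φ x) = chartDeriv φ x (W x) := by
  rw [chartField, φ.left_inv hx]

theorem chartField_zero (φ : OpenPartialHomeomorph M E) :
    chartField (0 : ∀ x : M, TangentSpace 𝓘(ℝ, E) x) φ = 0 :=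
  funext fun y => map_zero (chartDeriv φ (φ.symm y))

variable [IsManifold 𝓘(ℝ, E) ∞ M]

/-- The coordinate expression of the metric `h` in the chart `φ`: the function `chartMetric`, as a
field of continuous bilinear forms. -/
noncomputable def chartForm (h : Metric E M) (φ : OpenPartialHomeomorph M E) (y : E) :
    E →L[ℝ] E →L[ℝ] ℝ :=
  let g : E →L[ℝ] E →L[ℝ] ℝ := h.inner (φ.symm y)
  let d : E →L[ℝ] E := chartSymmDeriv φ y
  g.bilinearComp d d

/-- The Lagrangian of the navigation problem in the chart `φ`. -/
noncomputable def chartLagrangian (h : Metric E M) (W : ∀ x : M, TangentSpace 𝓘(ℝ, E) x)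
    (s : M → ℝ) (φ : OpenPartialHomeomorph M E) : QuadLagrangian E :=
  .navigation (chartForm h φ) (chartField W φ) (s ∘ φ.symm)

variable {φ : OpenPartialHomeomorph M E} {h : Metric E M}
  {W : ∀ x : M, TangentSpace 𝓘(ℝ, E) x} {s : M → ℝ} {x : M} {y : E}

theorem chartForm_apply (v w : E) :
    chartForm h φ y v w = h.inner (φ.symm y) (chartSymmDeriv φ y v) (chartSymmDeriv φ y w) := rfl

theorem chartMetric_eq_chartForm (v w : E) : chartMetric h φ y v w = chartForm h φ y v w := rfl

theorem chartDeriv_chartSymmDeriv (hφ : φ ∈ atlas E M) (hy : y ∈ φ.target) (v : E) :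
    chartDeriv φ (φ.symm y) (chartSymmDeriv φ y v) = v :=
  DFunLike.congr_fun ((mdifferentiable_of_mem_atlas (I := 𝓘(ℝ, E)) hφ).comp_symm_deriv hy) v

theorem chartSymmDeriv_chartDeriv (hφ : φ ∈ atlas E M) (hy : y ∈ φ.target)
    (u : TangentSpace 𝓘(ℝ, E) (φ.symm y)) :
    chartSymmDeriv φ y (chartDeriv φ (φ.symm y) u) = u := by
  have hinv := (mdifferentiable_of_mem_atlas (I := 𝓘(ℝ, E)) hφ).symm_comp_deriv (φ.map_target hy)
  -- The tangent spaces at `y` and at `φ (φ.symm y)` are not syntactically equal.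
  have hcast : ∀ y' : E, y' = y → ∀ a : E,
      (mfderiv 𝓘(ℝ, E) 𝓘(ℝ, E) φ.symm y' a : E) = chartSymmDeriv φ y a := by
    rintro y' rfl a
    rfl
  exact (hcast _ (φ.right_inv hy) _).symm.trans (DFunLike.congr_fun hinv u)

theorem inner_eq_chartForm (hφ : φ ∈ atlas E M) (hx : x ∈ φ.source)
    (u v : TangentSpace 𝓘(ℝ, E) x) :
    h.inner x u v = chartForm h φ (φ x) (chartDeriv φ x u) (chartDeriv φ x v) := by
  obtain ⟨y, hy, rfl⟩ : ∃ y ∈ φ.target, φ.symm y = x := ⟨φ x, φ.map_source hx, φ.left_inv hx⟩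
  rw [φ.right_inv hy, chartForm_apply, chartSymmDeriv_chartDeriv hφ hy,
    chartSymmDeriv_chartDeriv hφ hy]

theorem chartForm_symm (v w : E) : chartForm h φ y v w = chartForm h φ y w v := by
  rw [chartForm_apply, chartForm_apply, h.symm]

theorem chartForm_pos (hφ : φ ∈ atlas E M) (hy : y ∈ φ.target) (v : E) (hv : v ≠ 0) :
    0 < chartForm h φ y v v := by
  refine h.pos _ _ fun h0 => hv ?_
  rw [← chartDeriv_chartSymmDeriv hφ hy v]
  exact (congrArg _ h0).trans (map_zero (chartDeriv φ (φ.symm y)))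

theorem hnorm_sq (u : TangentSpace 𝓘(ℝ, E) x) : hnorm h x u ^ 2 = h.inner x u u := by
  refine Real.sq_sqrt ?_
  rcases eq_or_ne u 0 with rfl | hu
  · simp
  · exact (h.pos x u hu).le

theorem chartForm_self_nonneg {v : E} : 0 ≤ chartForm h φ y v v :=
  (sq_nonneg _).trans_eq (hnorm_sq (h := h) (chartSymmDeriv φ y v))

theorem hnorm_nonneg (u : TangentSpace 𝓘(ℝ, E) x) : 0 ≤ hnorm h x u := Real.sqrt_nonneg _

theorem hnorm_eq_iff (u : TangentSpace 𝓘(ℝ, E) x) {c : ℝ} (hc : 0 ≤ c) :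
    hnorm h x u = c ↔ h.inner x u u = c ^ 2 := by
  rw [← hnorm_sq, sq_eq_sq₀ (hnorm_nonneg u) hc]

theorem chartLagrangian_eval_chartDeriv (hφ : φ ∈ atlas E M) (hx : x ∈ φ.source)
    (u : TangentSpace 𝓘(ℝ, E) x) :
    (chartLagrangian h W s φ).eval (φ x) (chartDeriv φ x u) =
      h.inner x (u - W x) (u - W x) - s x ^ 2 := by
  rw [chartLagrangian, QuadLagrangian.navigation_eval chartForm_symm, inner_eq_chartForm hφ hx,
    chartField_apply W hx, Function.comp_apply, φ.left_inv hx, map_sub (chartDeriv φ x)]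

theorem chartLagrangian_eval_eq_zero_iff (hφ : φ ∈ atlas E M) (hx : x ∈ φ.source) (hs : 0 ≤ s x)
    (u : TangentSpace 𝓘(ℝ, E) x) :
    (chartLagrangian h W s φ).eval (φ x) (chartDeriv φ x u) = 0 ↔ hnorm h x (u - W x) = s x := by
  rw [chartLagrangian_eval_chartDeriv hφ hx, sub_eq_zero, hnorm_eq_iff _ hs]

theorem chartLagrangian_const_neg (hφ : φ ∈ atlas E M) (hx : x ∈ φ.source)
    (hWs : hnorm h x (W x) < s x) : (chartLagrangian h W s φ).const (φ x) < 0 := by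
  have hW : chartForm h φ (φ x) (chartField W φ (φ x)) (chartField W φ (φ x)) =
      hnorm h x (W x) ^ 2 := by
    rw [hnorm_sq, inner_eq_chartForm hφ hx, chartField_apply W hx]
  have hs : (s ∘ φ.symm) (φ x) = s x := congrArg s (φ.left_inv hx)
  simp only [chartLagrangian, QuadLagrangian.navigation, hW, hs, sub_neg]
  exact pow_lt_pow_left₀ hWs (hnorm_nonneg _) two_ne_zero

theorem contMDiffOn_chartSymmDeriv (hφ : φ ∈ atlas E M) (v : E) :
    ContMDiffOn 𝓘(ℝ, E) 𝓘(ℝ, E).tangent ∞ (fun y : E =>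
      (⟨φ.symm y, chartSymmDeriv φ y v⟩ : TangentBundle 𝓘(ℝ, E) M)) φ.target := by
  have hsymm : ContMDiffOn 𝓘(ℝ, E) 𝓘(ℝ, E) ∞ φ.symm φ.target :=
    contMDiffOn_symm_of_mem_maximalAtlas (IsManifold.subset_maximalAtlas hφ)
  have hconst : ContMDiffOn 𝓘(ℝ, E) 𝓘(ℝ, E).tangent ∞
      (fun y : E => (⟨y, v⟩ : TangentBundle 𝓘(ℝ, E) E)) φ.target :=
    contMDiffOn_vectorSpace_iff_contDiffOn.2 contDiffOn_const
  refine ((hsymm.contMDiffOn_tangentMapWithin (m := ∞) (by simp)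
    φ.open_target.uniqueMDiffOn).comp hconst fun y hy => hy).congr fun y hy => ?_
  simp only [Function.comp_apply, tangentMapWithin]
  rw [mfderivWithin_of_isOpen φ.open_target hy]
  rfl

theorem contDiffAt_chartForm [FiniteDimensional ℝ E] (hφ : φ ∈ atlas E M) (hy : y ∈ φ.target) :
    ContDiffAt ℝ ∞ (chartForm h φ) y := by
  refine ContDiffOn.contDiffAt ?_ (φ.open_target.mem_nhds hy)
  refine contDiffOn_clm_apply.2 fun v => contDiffOn_clm_apply.2 fun w => ?_
  have hh : ContMDiffOn 𝓘(ℝ, E) (𝓘(ℝ, E).prod 𝓘(ℝ, E →L[ℝ] E →L[ℝ] ℝ)) ∞ (fun y : E =>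
      TotalSpace.mk' (E →L[ℝ] E →L[ℝ] ℝ)
        (E := fun x : M => TangentSpace 𝓘(ℝ, E) x →L[ℝ] TangentSpace 𝓘(ℝ, E) x →L[ℝ] ℝ)
        (φ.symm y) (h.inner (φ.symm y))) φ.target :=
    h.contMDiff.comp_contMDiffOn
      (contMDiffOn_symm_of_mem_maximalAtlas (IsManifold.subset_maximalAtlas hφ))
  have happly := ContMDiffOn.clm_bundle_apply₂ (F₁ := E) (F₂ := E) (F₃ := ℝ)
    (E₁ := fun x : M => TangentSpace 𝓘(ℝ, E) x) (E₂ := fun x : M => TangentSpace 𝓘(ℝ, E) x)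
    (E₃ := Bundle.Trivial M ℝ) hh (contMDiffOn_chartSymmDeriv hφ v)
    (contMDiffOn_chartSymmDeriv hφ w)
  exact fun y hy => (contMDiffWithinAt_totalSpace.1 (happly y hy)).2.contDiffWithinAt

theorem contDiffAt_chartField {n : WithTop ℕ∞} (hn : n + 1 ≤ ∞)
    (hW : ContMDiff 𝓘(ℝ, E) 𝓘(ℝ, E).tangent n (fun x => (⟨x, W x⟩ : TangentBundle 𝓘(ℝ, E) M)))
    (hφ : φ ∈ atlas E M) (hy : y ∈ φ.target) : ContDiffAt ℝ n (chartField W φ) y := by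
  have hφ' := IsManifold.subset_maximalAtlas (I := 𝓘(ℝ, E)) (n := ∞) hφ
  have htangent := ((contMDiffOn_of_mem_maximalAtlas hφ').contMDiffOn_tangentMapWithin hn
    φ.open_source.uniqueMDiffOn).comp (hW.comp_contMDiffOn
      ((contMDiffOn_symm_of_mem_maximalAtlas hφ').of_le (le_self_add.trans hn)))
        (fun y hy => φ.map_target hy)
  have hsnd := ((contMDiff_snd_tangentBundle_modelSpace E 𝓘(ℝ, E)).of_le
    (le_top : n ≤ _)).comp_contMDiffOn htangent
  refine (hsnd.contDiffOn.congr fun y hy => ?_).contDiffAt (φ.open_target.mem_nhds hy)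
  have hderiv := mfderivWithin_of_isOpen (I := 𝓘(ℝ, E)) (I' := 𝓘(ℝ, E)) (f := φ) φ.open_source
    (φ.map_target hy)
  exact (DFunLike.congr_fun hderiv (W (φ.symm y))).symm

theorem contDiffAt_comp_chart_symm {n : WithTop ℕ∞} (hn : n ≤ ∞)
    (hs : ContMDiff 𝓘(ℝ, E) 𝓘(ℝ, ℝ) n s) (hφ : φ ∈ atlas E M) (hy : y ∈ φ.target) :
    ContDiffAt ℝ n (s ∘ φ.symm) y := by
  have hsymm : ContMDiffOn 𝓘(ℝ, E) 𝓘(ℝ, E) n φ.symm φ.target :=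
    (contMDiffOn_symm_of_mem_maximalAtlas (IsManifold.subset_maximalAtlas hφ)).of_le hn
  exact ((ContMDiff.comp_contMDiffOn (I' := 𝓘(ℝ, E)) hs hsymm).contMDiffAt
    (φ.open_target.mem_nhds hy)).contDiffAt

theorem isRegularAt_chartLagrangian [FiniteDimensional ℝ E]
    (hW : ContMDiff 𝓘(ℝ, E) 𝓘(ℝ, E).tangent 2 (fun x => (⟨x, W x⟩ : TangentBundle 𝓘(ℝ, E) M)))
    (hs : ContMDiff 𝓘(ℝ, E) 𝓘(ℝ, ℝ) 2 s) (hφ : φ ∈ atlas E M) (hy : y ∈ φ.target) :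
    (chartLagrangian h W s φ).IsRegularAt y :=
  QuadLagrangian.isRegularAt_navigation ((contDiffAt_chartForm hφ hy).of_le (by norm_cast))
    (contDiffAt_chartField (by norm_cast) hW hφ hy)
    (contDiffAt_comp_chart_symm (by norm_cast) hs hφ hy)
    (Eventually.of_forall fun _ => chartForm_symm) (chartForm_pos hφ hy)

end Charts

section Curves

theorem mapsTo_Icc_of_forall_mapsTo_imp {X : Type*} [TopologicalSpace X] {σ : ℝ → X} {U K : Set X}
    {a b : ℝ} (hσ : ContinuousOn σ (Icc a b)) (hU : IsOpen U) (hK : IsClosed K) (hUK : U ⊆ K)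
    (ha : σ a ∈ U) (hstep : ∀ t ∈ Icc a b, MapsTo σ (Icc a t) K → σ t ∈ U) :
    MapsTo σ (Icc a b) U := by
  by_contra hexit
  obtain ⟨t₁, ht₁, ht₁U⟩ : ∃ t ∈ Icc a b, σ t ∉ U := by
    simpa only [MapsTo, not_forall, exists_prop] using hexit
  have hcompact : IsCompact (Icc a b ∩ σ ⁻¹' Uᶜ) :=
    isCompact_Icc.of_isClosed_subset
      (hσ.preimage_isClosed_of_isClosed isClosed_Icc hU.isClosed_compl) inter_subset_left
  obtain ⟨t₀, ⟨ht₀, ht₀U⟩, hleast⟩ := hcompact.exists_isLeast ⟨t₁, ht₁, ht₁U⟩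
  have hat₀ : a < t₀ := ht₀.1.lt_of_ne fun h => ht₀U (h ▸ ha)
  have hbefore : MapsTo σ (Ico a t₀) K := fun t ht => hUK <| by
    by_contra htU
    exact (hleast ⟨⟨ht.1, ht.2.le.trans ht₀.2⟩, htU⟩).not_gt ht.2
  have hclosure := hbefore.closure_of_continuousOn
    (by rw [closure_Ico hat₀.ne]; exact hσ.mono (Icc_subset_Icc_right ht₀.2))
  rw [closure_Ico hat₀.ne, hK.closure_eq] at hclosure
  exact ht₀U (hstep t₀ ht₀ hclosure)

theorem eventuallyEq_symm_chart {X Y : Type*} [TopologicalSpace X] [TopologicalSpace Y]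
    {φ : OpenPartialHomeomorph X Y} {γ : ℝ → X} {t : ℝ} (hγ : ContinuousAt γ t)
    (ht : γ t ∈ φ.source) : γ =ᶠ[𝓝 t] φ.symm ∘ (φ ∘ γ) := by
  filter_upwards [hγ.eventually (φ.open_source.mem_nhds ht)] with r hr
  exact (φ.left_inv hr).symm

theorem continuousAt_of_chart {X Y : Type*} [TopologicalSpace X] [TopologicalSpace Y]
    {φ : OpenPartialHomeomorph X Y} {γ : ℝ → X} {t : ℝ} (hsrc : ∀ᶠ r in 𝓝 t, γ r ∈ φ.source)
    (hγ : ContinuousAt (φ ∘ γ) t) : ContinuousAt γ t :=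
  (ContinuousAt.comp (f := φ ∘ γ) (φ.continuousAt_symm (φ.map_source hsrc.self_of_nhds)) hγ).congr
    (hsrc.mono fun _ hr => φ.left_inv hr)

theorem eventuallyEq_chart_symm {X Y : Type*} [TopologicalSpace X] [TopologicalSpace Y]
    {φ : OpenPartialHomeomorph X Y} {y : ℝ → Y} {t : ℝ} (hy : ContinuousAt y t)
    (ht : y t ∈ φ.target) : φ ∘ (φ.symm ∘ y) =ᶠ[𝓝 t] y :=
  (eventuallyEq_symm_chart (φ := φ.symm) hy ht).symm

variable {E : Type*} [NormedAddCommGroup E] [NormedSpace ℝ E]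
  {M : Type*} [TopologicalSpace M] [ChartedSpace E M] [IsManifold 𝓘(ℝ, E) ∞ M]
  {φ : OpenPartialHomeomorph M E} {γ : ℝ → M} {t : ℝ}

theorem hasDerivAt_chart_comp (hφ : φ ∈ atlas E M) (ht : γ t ∈ φ.source)
    (hγ : MDifferentiableAt 𝓘(ℝ, ℝ) 𝓘(ℝ, E) γ t) :
    HasDerivAt (φ ∘ γ) (chartDeriv φ (γ t) (velocity E γ t)) t := by
  have hmfderiv := ((mdifferentiable_of_mem_atlas (I := 𝓘(ℝ, E)) hφ).mdifferentiableAt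
    ht).hasMFDerivAt.comp t hγ.hasMFDerivAt
  let L : ℝ →L[ℝ] E := (chartDeriv φ (γ t)).comp (mfderiv 𝓘(ℝ, ℝ) 𝓘(ℝ, E) γ t)
  have hfderiv : HasFDerivAt (φ ∘ γ) L t := hasMFDerivAt_iff_hasFDerivAt.1 hmfderiv
  exact hfderiv.hasDerivAt

theorem contMDiffAt_of_chart (hφ : φ ∈ atlas E M) (hγ : ContinuousAt γ t) (ht : γ t ∈ φ.source)
    (hderiv : ContDiffAt ℝ 1 (φ ∘ γ) t) : ContMDiffAt 𝓘(ℝ, ℝ) 𝓘(ℝ, E) 1 γ t := by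
  have hsymm : ContMDiffAt 𝓘(ℝ, E) 𝓘(ℝ, E) 1 φ.symm ((φ ∘ γ) t) :=
    ((contMDiffOn_symm_of_mem_maximalAtlas (n := ∞)
      (IsManifold.subset_maximalAtlas hφ)).contMDiffAt
      (φ.open_target.mem_nhds (φ.map_source ht))).of_le (by norm_num)
  exact (hsymm.comp t hderiv.contMDiffAt).congr_of_eventuallyEq (eventuallyEq_symm_chart hγ ht)

theorem mdifferentiableAt_of_chart (hφ : φ ∈ atlas E M) (hγ : ContinuousAt γ t)
    (ht : γ t ∈ φ.source) (hderiv : DifferentiableAt ℝ (φ ∘ γ) t) :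
    MDifferentiableAt 𝓘(ℝ, ℝ) 𝓘(ℝ, E) γ t := by
  have hsymm : MDifferentiableAt 𝓘(ℝ, E) 𝓘(ℝ, E) φ.symm ((φ ∘ γ) t) :=
    (mdifferentiable_of_mem_atlas hφ).mdifferentiableAt_symm (φ.map_source ht)
  exact (hsymm.comp t hderiv.mdifferentiableAt).congr_of_eventuallyEq
    (eventuallyEq_symm_chart hγ ht)

theorem chartDeriv_velocity (hφ : φ ∈ atlas E M) (hγ : ContinuousAt γ t) (ht : γ t ∈ φ.source)
    {v : E} (hderiv : HasDerivAt (φ ∘ γ) v t) : chartDeriv φ (γ t) (velocity E γ t) = v :=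
  (hasDerivAt_chart_comp hφ ht
    (mdifferentiableAt_of_chart hφ hγ ht hderiv.differentiableAt)).unique hderiv

end Curves

section Trajectories

variable {E : Type*} [NormedAddCommGroup E] [NormedSpace ℝ E]
  {M : Type*} [TopologicalSpace M] [ChartedSpace E M] [IsManifold 𝓘(ℝ, E) ∞ M]
  {φ : OpenPartialHomeomorph M E} {h : Metric E M} {W : ∀ x : M, TangentSpace 𝓘(ℝ, E) x}
  {s : M → ℝ} {γ : ℝ → M} {a b : ℝ}

theorem IsTrajectory.mono {a' b' : ℝ} (hγ : IsTrajectory h W s γ a b) (ha : a ≤ a') (hb : b' ≤ b) :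
    IsTrajectory h W s γ a' b' := by
  obtain ⟨hcont, S, hsmooth, hspeed⟩ := hγ
  exact ⟨hcont.mono (Icc_subset_Icc ha hb), S,
    fun c d hc hcd hd => hsmooth c d (ha.trans hc) hcd (hd.trans hb),
    fun t ht => hspeed t (Ioo_subset_Ioo ha hb ht)⟩

theorem IsTrajectory.exists_finset_mdifferentiableAt (hγ : IsTrajectory h W s γ a b) :
    ∃ S : Finset ℝ, ∀ t ∈ Ioo a b, t ∉ S → MDifferentiableAt 𝓘(ℝ, ℝ) 𝓘(ℝ, E) γ t ∧
      hnorm h (γ t) (velocity E γ t - W (γ t)) = s (γ t) := by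
  obtain ⟨-, S, hsmooth, hspeed⟩ := hγ
  refine ⟨S, fun t ht htS => ⟨?_, hspeed t ht htS⟩⟩
  have hnhds : Ioo a b ∩ (S : Set ℝ)ᶜ ∈ 𝓝 t :=
    inter_mem (Ioo_mem_nhds ht.1 ht.2) (S.finite_toSet.isClosed.isOpen_compl.mem_nhds htS)
  obtain ⟨ε, hε, hsub⟩ := (nhds_basis_Icc_pos t).mem_iff.1 hnhds
  have hlt : t - ε < t + ε := by linarith
  have hIcc := hsmooth (t - ε) (t + ε) (hsub (left_mem_Icc.2 hlt.le)).1.1.le hlt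
    (hsub (right_mem_Icc.2 hlt.le)).1.2.le fun r hr => (hsub (Ioo_subset_Icc_self hr)).2
  exact (hIcc.contMDiffAt (Icc_mem_nhds (by linarith) (by linarith))).mdifferentiableAt one_ne_zero

theorem isTrajectory_of_chart (hs : ∀ x, 0 ≤ s x)
    (hγ : ∀ t ∈ Icc a b, ContinuousAt γ t ∧ ∃ φ ∈ atlas E M, γ t ∈ φ.source ∧
      ContDiffAt ℝ 1 (φ ∘ γ) t ∧ ∃ v, HasDerivAt (φ ∘ γ) v t ∧
        (chartLagrangian h W s φ).eval ((φ ∘ γ) t) v = 0) :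
    IsTrajectory h W s γ a b := by
  refine ⟨fun t ht => (hγ t ht).1.continuousWithinAt, ∅,
    fun _ _ hc _ hd _ t ht => ContMDiffAt.contMDiffWithinAt ?_, fun t ht _ => ?_⟩
  · obtain ⟨hcont, φ, hφ, hsrc, hsmooth, -⟩ := hγ t ⟨hc.trans ht.1, ht.2.trans hd⟩
    exact contMDiffAt_of_chart hφ hcont hsrc hsmooth
  · obtain ⟨hcont, φ, hφ, hsrc, -, v, hv, heval⟩ := hγ t (Ioo_subset_Icc_self ht)
    rwa [← chartLagrangian_eval_eq_zero_iff hφ hsrc (hs _), chartDeriv_velocity hφ hcont hsrc hv]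

theorem isTrajectory_symm_comp (hφ : φ ∈ atlas E M) (hs : ∀ x, 0 ≤ s x) {y v : ℝ → E}
    (hy : ∀ t ∈ Icc a b, y t ∈ φ.target) (hsmooth : ∀ t ∈ Icc a b, ContDiffAt ℝ 1 y t)
    (hv : ∀ t ∈ Icc a b, HasDerivAt y (v t) t)
    (heval : ∀ t ∈ Icc a b, (chartLagrangian h W s φ).eval (y t) (v t) = 0) :
    IsTrajectory h W s (φ.symm ∘ y) a b := by
  refine isTrajectory_of_chart hs fun t ht => ?_
  have heq : φ ∘ (φ.symm ∘ y) =ᶠ[𝓝 t] y :=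
    eventuallyEq_chart_symm (hv t ht).continuousAt (hy t ht)
  exact ⟨(φ.continuousAt_symm (hy t ht)).comp (hv t ht).continuousAt, φ, hφ,
    φ.map_target (hy t ht), (hsmooth t ht).congr_of_eventuallyEq heq, v t,
    (hv t ht).congr_of_eventuallyEq heq, by rw [heq.self_of_nhds, heval t ht]⟩

theorem IsTrajectory.exists_hasDerivAt_chart (hγ : IsTrajectory h W s γ a b) (hφ : φ ∈ atlas E M)
    (hs : ∀ x, 0 ≤ s x) (hsrc : ∀ t ∈ Ioo a b, γ t ∈ φ.source) :
    ∃ (u : ℝ → E) (S : Finset ℝ), ∀ t ∈ Ioo a b, t ∉ S →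
      HasDerivAt (φ ∘ γ) (u t) t ∧ (chartLagrangian h W s φ).eval ((φ ∘ γ) t) (u t) = 0 := by
  obtain ⟨S, hS⟩ := hγ.exists_finset_mdifferentiableAt
  refine ⟨fun t => chartDeriv φ (γ t) (velocity E γ t), S, fun t ht htS => ?_⟩
  obtain ⟨hdiff, hspeed⟩ := hS t ht htS
  exact ⟨hasDerivAt_chart_comp hφ (hsrc t ht) hdiff,
    (chartLagrangian_eval_eq_zero_iff hφ (hsrc t ht) (hs _) _).2 hspeed⟩

theorem IsTrajectory.norm_chart_sub_le (hγ : IsTrajectory h W s γ a b) (hφ : φ ∈ atlas E M)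
    (hs : ∀ x, 0 ≤ s x) (hab : a ≤ b) (hsrc : ∀ t ∈ Icc a b, γ t ∈ φ.source) {C : ℝ}
    (hC : ∀ t ∈ Ioo a b, ∀ v, (chartLagrangian h W s φ).eval (φ (γ t)) v = 0 → ‖v‖ ≤ C) :
    ‖φ (γ b) - φ (γ a)‖ ≤ C * (b - a) := by
  obtain ⟨u, S, hu⟩ := hγ.exists_hasDerivAt_chart hφ hs fun t ht => hsrc t (Ioo_subset_Icc_self ht)
  exact norm_sub_le_of_hasDerivAt_of_notMem_finset S hab (φ.continuousOn.comp hγ.1 hsrc)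
    (fun t ht htS => (hu t ht htS).1) fun t ht htS => hC t ht _ (hu t ht htS).2

theorem IsSolution.continuousAt {J : Set ℝ} (hγ : IsSolution h W s γ J) {t : ℝ} (ht : J ∈ 𝓝 t) :
    ContinuousAt γ t := by
  obtain ⟨r, hr, hrJ⟩ := (nhds_basis_Icc_pos t).mem_iff.1 ht
  have hle : t - r ≤ t + r := by linarith
  exact (hγ.1 _ (hrJ (left_mem_Icc.2 hle)) _ (hrJ (right_mem_Icc.2 hle)) hle).1.continuousAt
    (Icc_mem_nhds (by linarith) (by linarith))

theorem exists_norm_le_of_chartLagrangian_eval_eq_zero [FiniteDimensional ℝ E]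
    (hφ : φ ∈ atlas E M) {y₀ : E} (hy₀ : y₀ ∈ φ.target) (hW : ContinuousAt (chartField W φ) y₀)
    (hs : ContinuousAt (s ∘ φ.symm) y₀) :
    ∃ C > 0, ∀ᶠ y in 𝓝 y₀, ∀ v, (chartLagrangian h W s φ).eval y v = 0 → ‖v‖ ≤ C :=
  QuadLagrangian.exists_norm_le_of_navigation_eval_eq_zero
    (contDiffAt_chartForm hφ hy₀).continuousAt hW hs (Eventually.of_forall fun _ => chartForm_symm)
    (chartForm_pos hφ hy₀)

theorem exists_forall_isTrajectory_mem [FiniteDimensional ℝ E] [T2Space M] (hφ : φ ∈ atlas E M)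
    (hs : ∀ x, 0 ≤ s x) {y₀ : E} (hy₀ : y₀ ∈ φ.target) {C : ℝ} (hC : 0 < C)
    (hbound : ∀ᶠ y in 𝓝 y₀, ∀ v, (chartLagrangian h W s φ).eval y v = 0 → ‖v‖ ≤ C) {N : Set E}
    (hN : N ∈ 𝓝 y₀) :
    ∃ δ > 0, ∀ (σ : ℝ → M) (T : ℝ), T ≤ δ → IsTrajectory h W s σ 0 T → σ 0 ∈ φ.source →
      φ (σ 0) ∈ Metric.ball y₀ δ → ∀ t ∈ Icc 0 T, σ t ∈ φ.source ∧ φ (σ t) ∈ N := by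
  obtain ⟨r, hr, hball⟩ := Metric.nhds_basis_closedBall.mem_iff.1
    (inter_mem hN (inter_mem (φ.open_target.mem_nhds hy₀) hbound))
  set K := φ.symm '' Metric.closedBall y₀ r
  set U := φ.source ∩ φ ⁻¹' Metric.ball y₀ r
  have hK : IsClosed K := by
    have := FiniteDimensional.proper_real E
    exact ((isCompact_closedBall y₀ r).image_of_continuousOn
      (φ.continuousOn_symm.mono fun y hy => (hball hy).2.1)).isClosed
  have hKφ : ∀ x ∈ K, x ∈ φ.source ∧ φ x ∈ Metric.closedBall y₀ r := by
    rintro _ ⟨y, hy, rfl⟩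
    exact ⟨φ.map_target (hball hy).2.1, by rwa [φ.right_inv (hball hy).2.1]⟩
  have hUK : U ⊆ K := fun x hx => ⟨φ x, Metric.ball_subset_closedBall hx.2, φ.left_inv hx.1⟩
  have hδ : r / (C + 1) ≤ r := div_le_self hr.le (by linarith)
  refine ⟨r / (C + 1), by positivity, fun σ T hT hσ hσ₀ hσy₀ => ?_⟩
  suffices hU : MapsTo σ (Icc 0 T) U from fun t ht =>
    ⟨(hU ht).1, (hball (Metric.ball_subset_closedBall (hU ht).2)).1⟩
  refine mapsTo_Icc_of_forall_mapsTo_imp hσ.1 (φ.isOpen_inter_preimage Metric.isOpen_ball) hK hUK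
    ⟨hσ₀, Metric.ball_subset_ball hδ hσy₀⟩ fun t ht htK => ?_
  have hmove := (hσ.mono le_rfl ht.2).norm_chart_sub_le hφ hs ht.1 (fun q hq => (hKφ _ (htK hq)).1)
    fun q hq => (hball (hKφ _ (htK (Ioo_subset_Icc_self hq))).2).2.2
  refine ⟨(hKφ _ (htK (right_mem_Icc.2 ht.1))).1, mem_ball_iff_norm.2 ?_⟩
  rw [mem_ball_iff_norm] at hσy₀
  calc ‖φ (σ t) - y₀‖ ≤ ‖φ (σ t) - φ (σ 0)‖ + ‖φ (σ 0) - y₀‖ := norm_sub_le_norm_sub_add_norm_sub ..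
    _ < C * (r / (C + 1)) + r / (C + 1) := by
        have : C * (t - 0) ≤ C * (r / (C + 1)) := by gcongr; linarith [ht.2]
        linarith
    _ = r := by field_simp

theorem IsTrajectory.exists_slower_chart_curve (hσ : IsTrajectory h W s γ 0 b) (hb : 0 ≤ b)
    (hφ : φ ∈ atlas E M) (hWs : ∀ x, hnorm h x (W x) < s x)
    (hsrc : ∀ t ∈ Icc 0 b, γ t ∈ φ.source) {t₁ t₂ : ℝ} (hlt : b < t₂ - t₁) :
    ∃ (z u : ℝ → E) (S : Finset ℝ), z t₁ = φ (γ 0) ∧ z t₂ = φ (γ b) ∧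
      ContinuousOn z (Icc t₁ t₂) ∧ MapsTo z (Icc t₁ t₂) (φ ∘ γ '' Icc 0 b) ∧
      ∀ t ∈ Ioo t₁ t₂, t ∉ S →
        HasDerivAt z (u t) t ∧ (chartLagrangian h W s φ).eval (z t) (u t) < 0 := by
  obtain ⟨u, S, hu⟩ := hσ.exists_hasDerivAt_chart hφ
    (fun x => (hnorm_nonneg _).trans (hWs x).le) fun t ht => hsrc t (Ioo_subset_Icc_self ht)
  exact QuadLagrangian.exists_reparam_eval_neg hb hlt (φ.continuousOn.comp hσ.1 hsrc) hu
    (fun _ _ _ => chartForm_self_nonneg) fun t ht =>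
      chartLagrangian_const_neg hφ (hsrc t ht) (hWs _)

theorem exists_nhds_forall_le_of_isExtremalAt [FiniteDimensional ℝ E] [T2Space M]
    (hW : ContMDiff 𝓘(ℝ, E) 𝓘(ℝ, E).tangent 2 (fun x => (⟨x, W x⟩ : TangentBundle 𝓘(ℝ, E) M)))
    (hs : ContMDiff 𝓘(ℝ, E) 𝓘(ℝ, ℝ) 2 s) (hWs : ∀ x, hnorm h x (W x) < s x)
    (hφ : φ ∈ atlas E M) {t₀ : ℝ} {v : ℝ → E} {μ : ℝ → ℝ} (hγ : ContinuousAt γ t₀)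
    (hsrc : γ t₀ ∈ φ.source) (hv : ContinuousAt v t₀) (hμ : ContinuousAt μ t₀) (hμ₀ : 0 < μ t₀)
    (hext : ∀ᶠ t in 𝓝 t₀, (chartLagrangian h W s φ).IsExtremalAt μ (φ ∘ γ) v t ∧
      (chartLagrangian h W s φ).eval ((φ ∘ γ) t) (v t) = 0) :
    ∃ U ∈ 𝓝 t₀, ∀ t₁ ∈ U, ∀ t₂ ∈ U, t₁ ≤ t₂ → ∀ (σ : ℝ → M) (T : ℝ), 0 ≤ T →
      IsTrajectory h W s σ 0 T → σ 0 = γ t₁ → σ T = γ t₂ → t₂ - t₁ ≤ T := by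
  have hs₀ : ∀ x, 0 ≤ s x := fun x => (hnorm_nonneg _).trans (hWs x).le
  have hy₀ : φ (γ t₀) ∈ φ.target := φ.map_source hsrc
  have hreg : (chartLagrangian h W s φ).IsRegularAt (φ (γ t₀)) :=
    isRegularAt_chartLagrangian hW hs hφ hy₀
  obtain ⟨C, hC, hbound⟩ := exists_norm_le_of_chartLagrangian_eval_eq_zero (h := h) hφ hy₀
    (contDiffAt_chartField (by norm_cast) hW hφ hy₀).continuousAt
    (contDiffAt_comp_chart_symm (by norm_cast) hs hφ hy₀).continuousAt
  obtain ⟨V, hV, ε, hε, hoptimal⟩ :=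
    hreg.not_eval_neg_of_isExtremalAt (‖v t₀‖ + 1) (μ t₀ + 1) (half_pos hμ₀)
  obtain ⟨δ, hδ, hstay⟩ := exists_forall_isTrajectory_mem hφ hs₀ hy₀ hC hbound hV
  have hφγ : ContinuousAt (φ ∘ γ) t₀ := (φ.continuousAt hsrc).comp hγ
  obtain ⟨η, hη, hnear⟩ := Metric.eventually_nhds_iff_ball.1 <|
    (hγ.eventually (φ.open_source.mem_nhds hsrc)).and <|
    (hφγ.eventually (Metric.ball_mem_nhds _ hδ)).and <| (hφγ.eventually hV).and <|
    (hv.norm.eventually_le_const (lt_add_one _)).and <|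
    (hμ.eventually (Icc_mem_nhds (half_lt_self hμ₀) (lt_add_one _))).and hext
  refine ⟨Metric.ball t₀ (min η (min ε δ / 2)), Metric.ball_mem_nhds _ (by positivity),
    fun t₁ ht₁ t₂ ht₂ _ σ T hT hσ hσ₀ hσT => ?_⟩
  by_contra! hlt
  have hIcc : ∀ t ∈ Icc t₁ t₂, t ∈ Metric.ball t₀ η := fun t ht =>
    Metric.ball_subset_ball (min_le_left _ _) ((convex_ball _ _).ordConnected.out ht₁ ht₂ ht)
  have hlen : t₂ - t₁ ≤ min ε δ := by
    have hdist := (dist_triangle_right t₂ t₁ t₀).trans (add_le_add ht₂.le ht₁.le)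
    rw [Real.dist_eq] at hdist
    linarith [le_abs_self (t₂ - t₁), min_le_right η (min ε δ / 2)]
  have ht₁₂ : t₁ < t₂ := sub_pos.1 (hT.trans_lt hlt)
  obtain ⟨hsrc₁, hball₁, -⟩ := hnear t₁ (hIcc t₁ (left_mem_Icc.2 ht₁₂.le))
  have hσV := hstay σ T (hlt.le.trans (hlen.trans (min_le_right _ _))) hσ (hσ₀ ▸ hsrc₁)
    (hσ₀ ▸ hball₁)
  obtain ⟨z, u, S, hz₁, hz₂, hz, hzσ, hneg⟩ :=
    hσ.exists_slower_chart_curve hT hφ hWs (fun t ht => (hσV t ht).1) hlt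
  refine hoptimal t₁ t₂ (φ ∘ γ) v z u μ S ht₁₂ (hlen.trans (min_le_left _ _))
    (fun t ht => ?_) (fun t ht => (hnear t (hIcc t ht)).2.2.2.2.2.2) hz
    (fun t ht => image_subset_iff.2 (fun q hq => (hσV q hq).2) (hzσ ht))
    (hz₁.trans (congrArg φ hσ₀)) (hz₂.trans (congrArg φ hσT)) hneg
  obtain ⟨-, -, htV, hvt, hμt, hextt, -⟩ := hnear t (hIcc t ht)
  exact ⟨hextt, htV, hvt, hμt⟩

end Trajectories

section RiemannianGeodesics

variable {E : Type*} [NormedAddCommGroup E] [NormedSpace ℝ E]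
  {M : Type*} [TopologicalSpace M] [ChartedSpace E M] [IsManifold 𝓘(ℝ, E) ∞ M]
  {φ : OpenPartialHomeomorph M E} {h : Metric E M} {γ : ℝ → M} {c : ℝ}

theorem hnorm_velocity_eq_iff (hφ : φ ∈ atlas E M) {t : ℝ} (hγ : ContinuousAt γ t)
    (ht : γ t ∈ φ.source) {v : E} (hv : HasDerivAt (φ ∘ γ) v t) (hc : 0 ≤ c) :
    hnorm h (γ t) (velocity E γ t) = c ↔ chartForm h φ ((φ ∘ γ) t) v v = c ^ 2 := by
  rw [hnorm_eq_iff _ hc, inner_eq_chartForm hφ ht, chartDeriv_velocity hφ hγ ht hv,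
    Function.comp_apply]

theorem chartLagrangian_zero_const :
    chartLagrangian h 0 (fun _ => c) φ = ⟨chartForm h φ, 0, fun _ => -c ^ 2⟩ := by
  rw [chartLagrangian, QuadLagrangian.navigation, QuadLagrangian.mk.injEq, chartField_zero]
  refine ⟨rfl, ?_, ?_⟩ <;> ext <;> simp

theorem chartLagrangian_zero_const_eval (y v : E) :
    (chartLagrangian h 0 (fun _ => c) φ).eval y v = chartForm h φ y v v - c ^ 2 := by
  simp [chartLagrangian_zero_const, QuadLagrangian.eval, sub_eq_add_neg]

theorem isExtremalAt_chartLagrangian_zero_const_iff {μ : ℝ → ℝ} {x v : ℝ → E} {t : ℝ} :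
    (chartLagrangian h 0 (fun _ => c) φ).IsExtremalAt μ x v t ↔
      (QuadLagrangian.energy (chartForm h φ)).IsExtremalAt μ x v t := by
  have hvel : ∀ y v, (chartLagrangian h 0 (fun _ => c) φ).velDeriv y v =
      (QuadLagrangian.energy (chartForm h φ)).velDeriv y v := fun y v => by
    rw [chartLagrangian_zero_const]
    rfl
  have hpos : ∀ y v, (chartLagrangian h 0 (fun _ => c) φ).posDeriv y v =
      (QuadLagrangian.energy (chartForm h φ)).posDeriv y v := fun y v => by
    rw [chartLagrangian_zero_const]
    simp [QuadLagrangian.posDeriv, QuadLagrangian.energy]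
  constructor <;>
    exact fun hx => ⟨hx.hasDerivAt, by simpa only [hvel, hpos] using hx.euler_lagrange⟩

variable [FiniteDimensional ℝ E]

theorem isMetricAt_chartForm (hφ : φ ∈ atlas E M) {y : E} (hy : y ∈ φ.target) :
    IsMetricAt (chartForm h φ) y :=
  ⟨(contDiffAt_chartForm hφ hy).differentiableAt (by norm_num), chartForm_symm,
    chartForm_pos hφ hy⟩

theorem fderiv_chartMetric (hφ : φ ∈ atlas E M) {y : E} (hy : y ∈ φ.target) (u v w : E) :
    fderiv ℝ (fun z => chartMetric h φ z u v) y w = fderiv ℝ (chartForm h φ) y w u v := by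
  have hg := (isMetricAt_chartForm (h := h) hφ hy).differentiableAt.hasFDerivAt
  have h := (hg.clm_apply (hasFDerivAt_const u y)).clm_apply (hasFDerivAt_const v y)
  simp only [chartMetric_eq_chartForm]
  simp [h.fderiv]

theorem christoffel_self_eq (hφ : φ ∈ atlas E M) {y : E} (hy : y ∈ φ.target) (v ξ : E) :
    christoffel h φ y v v ξ = fderiv ℝ (chartForm h φ) y v v ξ -
      1 / 2 * fderiv ℝ (chartForm h φ) y ξ v v := by
  rw [christoffel, fderiv_chartMetric hφ hy, fderiv_chartMetric hφ hy]
  ring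

theorem geodesic_equation_iff (hφ : φ ∈ atlas E M) {y : E} (hy : y ∈ φ.target) (v a : E) :
    (∀ ξ, chartMetric h φ y a ξ + christoffel h φ y v v ξ = 0) ↔
      a = geodesicAcc (chartForm h φ) y v := by
  rw [eq_geodesicAcc_iff (chartForm_pos hφ hy)]
  refine forall_congr' fun ξ => ?_
  rw [christoffel_self_eq hφ hy, chartMetric_eq_chartForm, add_eq_zero_iff_eq_neg, neg_sub]

theorem isGeodesic_iff {J : Set ℝ} : IsGeodesic h γ J ↔ ∀ t₀ ∈ J, ∃ φ ∈ atlas E M,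
    (∀ᶠ t in 𝓝 t₀, γ t ∈ φ.source) ∧
      ∃ v, ∀ᶠ t in 𝓝 t₀, IsGeodesicAt (chartForm h φ) (φ ∘ γ) v t := by
  refine forall₂_congr fun t₀ _ => exists_congr fun φ => and_congr_right fun hφ =>
    and_congr_right fun hsrc => ⟨fun ⟨hsmooth, heq⟩ => ⟨deriv (φ ∘ γ), ?_⟩, fun ⟨v, hv⟩ => ?_⟩
  · have hdiff : ∀ᶠ t in 𝓝 t₀, DifferentiableAt ℝ (φ ∘ γ) t ∧
        DifferentiableAt ℝ (deriv (φ ∘ γ)) t := by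
      filter_upwards [hsmooth.eventually (by simp)] with t ht
      exact ⟨ht.differentiableAt two_ne_zero,
        (ht.derivWithin (m := 1) (by norm_num)).differentiableAt one_ne_zero⟩
    filter_upwards [hdiff, heq, hsrc] with t ht heq hsrc
    exact ⟨ht.1.hasDerivAt,
      (geodesic_equation_iff hφ (φ.map_source hsrc) _ _).1 heq ▸ ht.2.hasDerivAt⟩
  · have hy₀ := φ.map_source hsrc.self_of_nhds
    refine ⟨IsGeodesicAt.contDiffAt_two hv ((contDiffAt_chartForm hφ hy₀).of_le (by norm_cast))
      (chartForm_pos hφ hy₀), ?_⟩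
    have hderiv : deriv (φ ∘ γ) =ᶠ[𝓝 t₀] v := hv.mono fun t ht => ht.hasDerivAt_pos.deriv
    filter_upwards [hderiv.eventuallyEq_nhds, hv, hsrc] with t hd ht hsrc
    rw [geodesic_equation_iff hφ (φ.map_source hsrc), hd.deriv_eq, hd.self_of_nhds,
      ht.hasDerivAt_vel.deriv]
    rfl

end RiemannianGeodesics

section SolutionsWithoutWind

variable {E : Type*} [NormedAddCommGroup E] [NormedSpace ℝ E] [FiniteDimensional ℝ E]
  {M : Type*} [TopologicalSpace M] [ChartedSpace E M] [IsManifold 𝓘(ℝ, E) ∞ M]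
  {φ : OpenPartialHomeomorph M E} {h : Metric E M} {γ : ℝ → M} {c : ℝ} {J : Set ℝ}

theorem isTrajectory_symm_comp_of_isGeodesicAt (hφ : φ ∈ atlas E M) (hc : 0 ≤ c) {x v : ℝ → E}
    {a b : ℝ} (hx : ∀ t ∈ Icc a b, (∀ᶠ r in 𝓝 t, IsGeodesicAt (chartForm h φ) x v r) ∧
      x t ∈ φ.target ∧ chartForm h φ (x t) (v t) (v t) = c ^ 2) :
    IsTrajectory h 0 (fun _ => c) (φ.symm ∘ x) a b := by
  refine isTrajectory_symm_comp hφ (fun _ => hc) (fun t ht => (hx t ht).2.1) (fun t ht => ?_)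
    (fun t ht => (hx t ht).1.self_of_nhds.hasDerivAt_pos) fun t ht => ?_
  · obtain ⟨hgeo, htar, -⟩ := hx t ht
    exact (IsGeodesicAt.contDiffAt_two hgeo ((contDiffAt_chartForm hφ htar).of_le (by norm_cast))
      (chartForm_pos hφ htar)).of_le one_le_two
  · rw [chartLagrangian_zero_const_eval, (hx t ht).2.2, sub_self]

theorem eq_of_isGeodesicAt_of_chartForm_eq_zero (hφ : φ ∈ atlas E M) {x v : ℝ → E} {a b : ℝ}
    (hab : a ≤ b) (hx : ∀ t ∈ Icc a b, IsGeodesicAt (chartForm h φ) x v t ∧ x t ∈ φ.target)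
    (hv : chartForm h φ (x a) (v a) (v a) = 0) : x b = x a := by
  have hva : v a = 0 := by
    by_contra hne
    exact (chartForm_pos hφ (hx a (left_mem_Icc.2 hab)).2 _ hne).ne' hv
  exact IsGeodesicAt.eq_of_vel_eq_zero (fun t ht => (hx t ht).1)
    (fun t ht => isMetricAt_chartForm hφ (hx t ht).2) hva (right_mem_Icc.2 hab)

theorem exists_isTrajectory_of_isGeodesicAt (hφ : φ ∈ atlas E M) (hc : 0 < c) {k : ℝ} (hk : 0 ≤ k)
    {x v : ℝ → E} {t₁ t₂ : ℝ} (ht : t₁ ≤ t₂)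
    (hx : ∀ t ∈ Icc t₁ t₂, (∀ᶠ r in 𝓝 t, IsGeodesicAt (chartForm h φ) x v r) ∧ x t ∈ φ.target ∧
      chartForm h φ (x t) (v t) (v t) = k ^ 2) :
    ∃ (σ : ℝ → M) (T : ℝ), 0 ≤ T ∧ IsTrajectory h 0 (fun _ => c) σ 0 T ∧ σ 0 = φ.symm (x t₁) ∧
      σ T = φ.symm (x t₂) ∧ c * T = k * (t₂ - t₁) := by
  rcases hk.eq_or_lt with rfl | hk
  · have hxt : x t₂ = x t₁ := eq_of_isGeodesicAt_of_chartForm_eq_zero hφ ht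
      (fun t ht => ⟨(hx t ht).1.self_of_nhds, (hx t ht).2.1⟩)
      (by simpa using (hx t₁ (left_mem_Icc.2 ht)).2.2)
    exact ⟨fun _ => φ.symm (x t₁), 0, le_rfl,
      ⟨continuousOn_const, ∅, fun a b ha hab hb => (by linarith : False).elim, by simp⟩, rfl,
      congrArg φ.symm hxt.symm, by simp⟩
  have hl : ∀ t, HasDerivAt (fun r => t₁ + c / k * r) (c / k) t := fun t => by
    simpa using ((hasDerivAt_id t).const_mul (c / k)).const_add t₁
  have hT : c / k * (k / c * (t₂ - t₁)) = t₂ - t₁ := by field_simp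
  have hmaps : ∀ t ∈ Icc 0 (k / c * (t₂ - t₁)), t₁ + c / k * t ∈ Icc t₁ t₂ := fun t ht => by
    have h₀ : 0 ≤ c / k * t := mul_nonneg (by positivity) ht.1
    have h₁ : c / k * t ≤ c / k * (k / c * (t₂ - t₁)) :=
      mul_le_mul_of_nonneg_left ht.2 (by positivity)
    exact ⟨by linarith, by linarith⟩
  refine ⟨φ.symm ∘ (x ∘ fun r => t₁ + c / k * r), k / c * (t₂ - t₁),
    mul_nonneg (by positivity) (sub_nonneg.2 ht),
    isTrajectory_symm_comp_of_isGeodesicAt (v := fun r => (c / k) • v (t₁ + c / k * r)) hφ hc.le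
      fun t ht => ?_, by simp, by simp [hT], by field_simp⟩
  obtain ⟨hgeo, htar, hspeed⟩ := hx _ (hmaps t ht)
  refine ⟨((hl t).continuousAt.eventually hgeo).mono fun r hr => hr.comp (hl r), htar, ?_⟩
  simp only [Function.comp_apply, map_smul, smul_apply, smul_eq_mul, hspeed]
  field_simp

theorem sq_le_of_isGeodesicAt_of_forall_le (hφ : φ ∈ atlas E M) (hc : 0 < c) {κ : ℝ}
    {x v : ℝ → E} {t₁ t₂ : ℝ} (ht : t₁ < t₂)
    (hx : ∀ t ∈ Icc t₁ t₂, (∀ᶠ r in 𝓝 t, IsGeodesicAt (chartForm h φ) x v r) ∧ x t ∈ φ.target ∧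
      chartForm h φ (x t) (v t) (v t) = κ)
    (hopt : ∀ (σ : ℝ → M) (T : ℝ), 0 ≤ T → IsTrajectory h 0 (fun _ => c) σ 0 T →
      σ 0 = φ.symm (x t₁) → σ T = φ.symm (x t₂) → t₂ - t₁ ≤ T) : c ^ 2 ≤ κ := by
  have hκ : 0 ≤ κ := (hx t₁ (left_mem_Icc.2 ht.le)).2.2 ▸ chartForm_self_nonneg
  obtain ⟨σ, T, hT, hσ, hσ₀, hσT, hcT⟩ := exists_isTrajectory_of_isGeodesicAt (h := h) hφ hc
    (Real.sqrt_nonneg κ) ht.le fun t ht =>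
      ⟨(hx t ht).1, (hx t ht).2.1, (hx t ht).2.2.trans (Real.sq_sqrt hκ).symm⟩
  refine (Real.le_sqrt' hc).1 (le_of_mul_le_mul_right ?_ (sub_pos.2 ht))
  exact hcT ▸ mul_le_mul_of_nonneg_left (hopt σ T hT hσ hσ₀ hσT) hc.le

theorem exists_nhds_eqOn_of_sq_le (hφ : φ ∈ atlas E M) {y₀ : E} (hy₀ : y₀ ∈ φ.target)
    (hc : 0 ≤ c) (R : ℝ) :
    ∃ V ∈ 𝓝 y₀, ∃ ε > 0, ∀ (γ : ℝ → M) (x v : ℝ → E) (t₁ t₂ κ : ℝ), t₁ < t₂ → t₂ - t₁ ≤ ε →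
      IsTrajectory h 0 (fun _ => c) γ t₁ t₂ → (∀ t ∈ Icc t₁ t₂, γ t ∈ φ.source ∧ φ (γ t) ∈ V) →
      (∀ t ∈ Icc t₁ t₂, IsGeodesicAt (chartForm h φ) x v t ∧ x t ∈ V ∧
        chartForm h φ (x t) (v t) (v t) = κ ∧ ‖v t‖ ≤ R) → c ^ 2 ≤ κ →
      φ (γ t₁) = x t₁ → φ (γ t₂) = x t₂ → EqOn (φ ∘ γ) x (Icc t₁ t₂) ∧ κ = c ^ 2 := by
  have hreg : (chartLagrangian h 0 (fun _ => c) φ).IsRegularAt y₀ :=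
    isRegularAt_chartLagrangian (contMDiff_zeroSection ℝ _) contMDiff_const hφ hy₀
  obtain ⟨V, hV, ε, hε, hmin⟩ := hreg.exists_eqOn_of_isExtremalAt R 1 one_pos
  refine ⟨V ∩ φ.target, inter_mem hV (φ.open_target.mem_nhds hy₀), ε, hε,
    fun γ x v t₁ t₂ κ ht hlen hγ hγV hx hκ h₁ h₂ => ?_⟩
  obtain ⟨u, S, hu⟩ := hγ.exists_hasDerivAt_chart hφ (fun _ => hc) fun t ht =>
    (hγV t (Ioo_subset_Icc_self ht)).1
  have heq : EqOn (φ ∘ γ) x (Icc t₁ t₂) := by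
    refine hmin t₁ t₂ x v (φ ∘ γ) u (fun _ => 1) S hlen (fun t ht => ?_)
      (φ.continuousOn.comp hγ.1 fun t ht => (hγV t ht).1) (fun t ht => (hγV t ht).2.1)
      (fun t ht htS => ⟨(hu t ht htS).1, ?_⟩) h₁ h₂
    · obtain ⟨hgeo, hxV, -, hvR⟩ := hx t ht
      exact ⟨isExtremalAt_chartLagrangian_zero_const_iff.2
        (hgeo.isExtremalAt (isMetricAt_chartForm hφ hxV.2)), hxV.1, hvR, le_rfl, le_rfl⟩
    · rw [(hu t ht htS).2, chartLagrangian_zero_const_eval, (hx t (Ioo_subset_Icc_self ht)).2.2.1]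
      exact sub_nonneg.2 hκ
  refine ⟨heq, ?_⟩
  obtain ⟨t, ht, htS⟩ := (Ioo_infinite ht).exists_notMem_finset S
  obtain ⟨hgeo, -, hspeed, -⟩ := hx t (Ioo_subset_Icc_self ht)
  have huv : u t = v t := (hu t ht htS).1.unique (hgeo.hasDerivAt_pos.congr_of_eventuallyEq
    ((heq.mono Ioo_subset_Icc_self).eventuallyEq_of_mem (Ioo_mem_nhds ht.1 ht.2)))
  have heval := (hu t ht htS).2
  rwa [chartLagrangian_zero_const_eval, huv, heq (Ioo_subset_Icc_self ht), hspeed,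
    sub_eq_zero] at heval

theorem exists_nhds_isGeodesicAt_of_forall_le (hφ : φ ∈ atlas E M) {y₀ : E} (hy₀ : y₀ ∈ φ.target)
    (hc : 0 < c) :
    ∃ N ∈ 𝓝 y₀, ∃ ε > 0, ∀ (γ : ℝ → M) (t₁ t₂ : ℝ), t₁ < t₂ → t₂ - t₁ ≤ ε →
      IsTrajectory h 0 (fun _ => c) γ t₁ t₂ → (∀ t ∈ Icc t₁ t₂, γ t ∈ φ.source ∧ φ (γ t) ∈ N) →
      (∀ (σ : ℝ → M) (T : ℝ), 0 ≤ T → IsTrajectory h 0 (fun _ => c) σ 0 T → σ 0 = γ t₁ →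
        σ T = γ t₂ → t₂ - t₁ ≤ T) →
      ∃ v : ℝ → E, ∀ t ∈ Ioo t₁ t₂, IsGeodesicAt (chartForm h φ) (φ ∘ γ) v t ∧
        chartForm h φ ((φ ∘ γ) t) (v t) (v t) = c ^ 2 := by
  obtain ⟨C, -, hbound⟩ := exists_norm_le_of_chartLagrangian_eval_eq_zero (h := h) (W := 0)
    (s := fun _ => c) hφ hy₀ (by rw [chartField_zero]; exact continuousAt_const) continuousAt_const
  obtain ⟨Λ, hΛ, hbetween⟩ := exists_geodesic_between
    ((contDiffAt_chartForm (h := h) hφ hy₀).of_le (by norm_cast))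
    (Eventually.of_forall fun _ => chartForm_symm) (chartForm_pos hφ hy₀)
  obtain ⟨V, hV, ε, hε, hmin⟩ := exists_nhds_eqOn_of_sq_le (h := h) hφ hy₀ hc.le (Λ * C)
  obtain ⟨ρ, hρ, hgeo⟩ := hbetween _ (inter_mem hV (φ.open_target.mem_nhds hy₀))
  refine ⟨_, inter_mem (inter_mem hV (Metric.ball_mem_nhds y₀ hρ)) hbound, ε, hε,
    fun γ t₁ t₂ ht hlen hγ hγN hopt => ?_⟩
  have hl := left_mem_Icc.2 ht.le
  have hr := right_mem_Icc.2 ht.le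
  obtain ⟨x, v, κ, hx₁, hx₂, hx⟩ :=
    hgeo _ (hγN t₁ hl).2.1.2 _ (hγN t₂ hr).2.1.2 t₁ t₂ ht
  have hκc : c ^ 2 ≤ κ := sq_le_of_isGeodesicAt_of_forall_le (h := h) hφ hc ht
    (fun t ht => ⟨(hx t ht).1, (hx t ht).2.1.2, (hx t ht).2.2.1⟩) <| by
      rwa [hx₁, hx₂, φ.left_inv (hγN t₁ hl).1, φ.left_inv (hγN t₂ hr).1]
  have hvC : ∀ t ∈ Icc t₁ t₂, ‖v t‖ ≤ Λ * C := fun t htI => by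
    have hle := (hx t htI).2.2.2.trans <| mul_le_mul_of_nonneg_left (hγ.norm_chart_sub_le hφ
      (fun _ => hc.le) ht.le (fun r hr => (hγN r hr).1)
      fun r hr => (hγN r (Ioo_subset_Icc_self hr)).2.2) hΛ
    exact le_of_mul_le_mul_right (hle.trans_eq (mul_assoc _ _ _).symm) (sub_pos.2 ht)
  obtain ⟨heq, rfl⟩ := hmin γ x v t₁ t₂ κ ht hlen hγ (fun t ht => ⟨(hγN t ht).1, (hγN t ht).2.1.1⟩)
    (fun t ht => ⟨(hx t ht).1.self_of_nhds, (hx t ht).2.1.1, (hx t ht).2.2.1, hvC t ht⟩) hκc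
    hx₁.symm hx₂.symm
  refine ⟨v, fun t ht => ⟨(hx t (Ioo_subset_Icc_self ht)).1.self_of_nhds.congr_of_eventuallyEq
    ((heq.mono Ioo_subset_Icc_self).eventuallyEq_of_mem (Ioo_mem_nhds ht.1 ht.2)), ?_⟩⟩
  rw [heq (Ioo_subset_Icc_self ht), (hx t (Ioo_subset_Icc_self ht)).2.2.1]

theorem IsSolution.exists_isGeodesicAt (hc : 0 < c) (hγ : IsSolution h 0 (fun _ => c) γ J)
    (hφ : φ ∈ atlas E M) {t₀ : ℝ} (ht₀ : J ∈ 𝓝 t₀) (hsrc : γ t₀ ∈ φ.source) :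
    ∃ v, ∀ᶠ t in 𝓝 t₀, IsGeodesicAt (chartForm h φ) (φ ∘ γ) v t ∧
      chartForm h φ ((φ ∘ γ) t) (v t) (v t) = c ^ 2 := by
  have hcont := hγ.continuousAt ht₀
  obtain ⟨U, hU, hopt⟩ := hγ.2 t₀ (mem_of_mem_nhds ht₀)
  obtain ⟨N, hN, ε, hε, hgeo⟩ :=
    exists_nhds_isGeodesicAt_of_forall_le (h := h) hφ (φ.map_source hsrc) hc
  obtain ⟨r, hr, hnear⟩ := (nhds_basis_Icc_pos t₀).eventually_iff.1 <|
    (eventually_mem_set.2 (inter_mem hU ht₀)).and <|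
    (hcont.eventually (φ.open_source.mem_nhds hsrc)).and
    (((φ.continuousAt hsrc).comp hcont).eventually hN)
  have hδ : 0 < min r (ε / 2) := by positivity
  have hsub : Icc (t₀ - min r (ε / 2)) (t₀ + min r (ε / 2)) ⊆ Icc (t₀ - r) (t₀ + r) :=
    Icc_subset_Icc (by linarith [min_le_left r (ε / 2)]) (by linarith [min_le_left r (ε / 2)])
  have hlt : t₀ - min r (ε / 2) < t₀ + min r (ε / 2) := by linarith
  have hl := (hnear (hsub (left_mem_Icc.2 hlt.le))).1
  have hr := (hnear (hsub (right_mem_Icc.2 hlt.le))).1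
  obtain ⟨v, hv⟩ := hgeo γ _ _ hlt (by linarith [min_le_right r (ε / 2)])
    (hγ.1 _ hl.2 _ hr.2 hlt.le) (fun t ht => (hnear (hsub ht)).2) (hopt _ hl _ hr hlt.le)
  exact ⟨v, eventually_of_mem (Ioo_mem_nhds (by linarith) (by linarith)) hv⟩

theorem isGeodesicOfSpeed_of_isSolution (hc : 0 < c) (hJ : IsOpen J)
    (hγ : IsSolution h 0 (fun _ => c) γ J) : IsGeodesicOfSpeed h c γ J := by
  refine ⟨isGeodesic_iff.2 fun t₀ ht₀ => ?_, fun t₀ ht₀ => ?_⟩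
  all_goals
    have hcont := hγ.continuousAt (hJ.mem_nhds ht₀)
    have hφ := chart_mem_atlas E (γ t₀)
    have hsrc := mem_chart_source E (γ t₀)
    obtain ⟨v, hv⟩ := hγ.exists_isGeodesicAt hc hφ (hJ.mem_nhds ht₀) hsrc
  · exact ⟨_, hφ, hcont.eventually ((chartAt E _).open_source.mem_nhds hsrc), v,
      hv.mono fun t ht => ht.1⟩
  · obtain ⟨hgeo, hspeed⟩ := hv.self_of_nhds
    exact (hnorm_velocity_eq_iff hφ hcont hsrc hgeo.hasDerivAt_pos hc.le).2 hspeed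

end SolutionsWithoutWind

section BilinForm

variable {V : Type*} [AddCommGroup V] [Module ℝ V] {B : LinearMap.BilinForm ℝ V} {w : V} {r k : ℝ}

theorem exists_smul_apply_self_eq_sq (hr : 0 < r) {u : V} (hu : 0 < B u u) :
    ∃ a : ℝ, a ≠ 0 ∧ B (a • u) (a • u) = r ^ 2 := by
  refine ⟨r / √(B u u), (div_pos hr (Real.sqrt_pos.2 hu)).ne', ?_⟩
  simp only [map_smul, LinearMap.smul_apply, smul_eq_mul]
  rw [← mul_assoc, ← sq, div_pow, Real.sq_sqrt hu.le, div_mul_cancel₀ _ hu.ne']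

theorem eq_zero_and_sq_eq_of_apply_add_self_eq [Nontrivial V] (hsymm : ∀ u v, B u v = B v u)
    (hpos : ∀ u ≠ 0, 0 < B u u) (hr : 0 < r)
    (hB : ∀ u, B u u = r ^ 2 → B (u + w) (u + w) = k) : w = 0 ∧ r ^ 2 = k := by
  have horth : ∀ u, B u u = r ^ 2 → B u w = 0 := fun u hu => by
    have hadd := hB u hu
    have hneg := hB (-u) (by simpa using hu)
    simp only [map_add, map_neg, LinearMap.add_apply, LinearMap.neg_apply, hsymm w u] at hadd hneg
    linarith
  have hw : w = 0 := by
    by_contra hne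
    obtain ⟨a, ha, har⟩ := exists_smul_apply_self_eq_sq hr (hpos w hne)
    have haw := horth _ har
    rw [map_smul, LinearMap.smul_apply, smul_eq_mul] at haw
    exact mul_ne_zero ha (hpos w hne).ne' haw
  obtain ⟨u, hu⟩ := exists_ne (0 : V)
  obtain ⟨a, -, har⟩ := exists_smul_apply_self_eq_sq hr (hpos u hu)
  exact ⟨hw, by rw [← har, ← hB _ har, hw, add_zero]⟩

end BilinForm

section Extremals

variable {E : Type*} [NormedAddCommGroup E] [NormedSpace ℝ E] [FiniteDimensional ℝ E]
  {M : Type*} [TopologicalSpace M] [ChartedSpace E M] [IsManifold 𝓘(ℝ, E) ∞ M]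
  {h : Metric E M} {W : ∀ x : M, TangentSpace 𝓘(ℝ, E) x} {s : M → ℝ}

theorem exists_isExtremalAt_chartLagrangian
    (hW : ContMDiff 𝓘(ℝ, E) 𝓘(ℝ, E).tangent 2 (fun x => (⟨x, W x⟩ : TangentBundle 𝓘(ℝ, E) M)))
    (hs : ContMDiff 𝓘(ℝ, E) 𝓘(ℝ, ℝ) 2 s) {φ : OpenPartialHomeomorph M E} (hφ : φ ∈ atlas E M)
    {x₀ : M} (hx₀ : x₀ ∈ φ.source) (hs₀ : 0 < s x₀) {u : TangentSpace 𝓘(ℝ, E) x₀}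
    (hu : hnorm h x₀ (u - W x₀) = s x₀) :
    ∃ (y v : ℝ → E) (μ : ℝ → ℝ), y 0 = φ x₀ ∧ v 0 = chartDeriv φ x₀ u ∧ 0 < μ 0 ∧
      ∀ᶠ t in 𝓝 0, (chartLagrangian h W s φ).IsExtremalAt μ y v t ∧
        (chartLagrangian h W s φ).eval (y t) (v t) = 0 ∧ ContinuousAt v t ∧ ContinuousAt μ t := by
  have hy₀ := φ.map_source hx₀
  have hsφ : (s ∘ φ.symm) (φ x₀) = s x₀ := congrArg s (φ.left_inv hx₀)
  have hv₀ : chartDeriv φ x₀ (u - W x₀) + chartField W φ (φ x₀) = chartDeriv φ x₀ u := by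
    rw [chartField_apply W hx₀, ← map_add (chartDeriv φ x₀), sub_add_cancel]
  rw [hnorm_eq_iff _ hs₀.le, inner_eq_chartForm hφ hx₀, ← hsφ] at hu
  rw [← hv₀]
  exact QuadLagrangian.exists_isExtremalAt_navigation
    ((contDiffAt_chartForm hφ hy₀).of_le (by norm_cast))
    (contDiffAt_chartField (by norm_cast) hW hφ hy₀)
    (contDiffAt_comp_chart_symm (by norm_cast) hs hφ hy₀)
    (Eventually.of_forall fun _ => chartForm_symm) (chartForm_pos hφ hy₀) (hsφ ▸ hs₀) hu

end Extremals

section Solutions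

variable {E : Type*} [NormedAddCommGroup E] [NormedSpace ℝ E] [FiniteDimensional ℝ E]
  {M : Type*} [TopologicalSpace M] [T2Space M] [ChartedSpace E M] [IsManifold 𝓘(ℝ, E) ∞ M]
  {h : Metric E M} {W : ∀ x : M, TangentSpace 𝓘(ℝ, E) x} {s : M → ℝ}

theorem isSolution_of_isExtremalAt
    (hW : ContMDiff 𝓘(ℝ, E) 𝓘(ℝ, E).tangent 2 (fun x => (⟨x, W x⟩ : TangentBundle 𝓘(ℝ, E) M)))
    (hs : ContMDiff 𝓘(ℝ, E) 𝓘(ℝ, ℝ) 2 s) (hWs : ∀ x, hnorm h x (W x) < s x) {γ : ℝ → M}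
    {J : Set ℝ} (hJ : J.OrdConnected)
    (hγ : ∀ t ∈ J, ContinuousAt γ t ∧ ∃ φ ∈ atlas E M, γ t ∈ φ.source ∧
      ∃ (v : ℝ → E) (μ : ℝ → ℝ), ContinuousAt μ t ∧ 0 < μ t ∧ ∀ᶠ r in 𝓝 t, ContinuousAt v r ∧
        (chartLagrangian h W s φ).IsExtremalAt μ (φ ∘ γ) v r ∧
          (chartLagrangian h W s φ).eval ((φ ∘ γ) r) (v r) = 0) :
    IsSolution h W s γ J := by
  refine ⟨fun a ha b hb _ => ?_, fun t₀ ht₀ => ?_⟩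
  · refine isTrajectory_of_chart (fun x => (hnorm_nonneg _).trans (hWs x).le) fun t ht => ?_
    obtain ⟨hcont, φ, hφ, hsrc, v, μ, -, -, hext⟩ := hγ t (hJ.out ha hb ht)
    exact ⟨hcont, φ, hφ, hsrc, contDiffAt_one_of_hasDerivAt
      (hext.mono fun r hr => hr.2.1.hasDerivAt) (hext.mono fun r hr => hr.1), v t,
      hext.self_of_nhds.2.1.hasDerivAt, hext.self_of_nhds.2.2⟩
  · obtain ⟨hcont, φ, hφ, hsrc, v, μ, hμ, hμ₀, hext⟩ := hγ t₀ ht₀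
    obtain ⟨U, hU, hopt⟩ := exists_nhds_forall_le_of_isExtremalAt hW hs hWs hφ hcont hsrc
      hext.self_of_nhds.1 hμ hμ₀ (hext.mono fun r hr => hr.2)
    exact ⟨U, hU, fun t₁ ht₁ t₂ ht₂ => hopt t₁ ht₁.1 t₂ ht₂.1⟩

theorem isSolution_symm_comp
    (hW : ContMDiff 𝓘(ℝ, E) 𝓘(ℝ, E).tangent 2 (fun x => (⟨x, W x⟩ : TangentBundle 𝓘(ℝ, E) M)))
    (hs : ContMDiff 𝓘(ℝ, E) 𝓘(ℝ, ℝ) 2 s) (hWs : ∀ x, hnorm h x (W x) < s x)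
    {φ : OpenPartialHomeomorph M E} (hφ : φ ∈ atlas E M) {J : Set ℝ} (hJ : IsOpen J)
    (hJc : J.OrdConnected) {y v : ℝ → E} {μ : ℝ → ℝ}
    (hy : ∀ t ∈ J, ((chartLagrangian h W s φ).IsExtremalAt μ y v t ∧
      (chartLagrangian h W s φ).eval (y t) (v t) = 0 ∧ ContinuousAt v t ∧ ContinuousAt μ t) ∧
        y t ∈ φ.target ∧ 0 < μ t) :
    IsSolution h W s (φ.symm ∘ y) J := by
  refine isSolution_of_isExtremalAt hW hs hWs hJc fun t ht => ?_
  obtain ⟨⟨hext, -, -, hμ⟩, htar, hμ₀⟩ := hy t ht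
  refine ⟨(φ.continuousAt_symm htar).comp hext.hasDerivAt.continuousAt, φ, hφ,
    φ.map_target htar, v, μ, hμ, hμ₀, eventually_of_mem (hJ.mem_nhds ht) fun r hr => ?_⟩
  obtain ⟨⟨hext, heval, hv, -⟩, htar, -⟩ := hy r hr
  have heq := eventuallyEq_chart_symm hext.hasDerivAt.continuousAt htar
  exact ⟨hv, hext.congr_of_eventuallyEq heq, by rwa [heq.self_of_nhds]⟩

theorem exists_isSolution
    (hW : ContMDiff 𝓘(ℝ, E) 𝓘(ℝ, E).tangent 2 (fun x => (⟨x, W x⟩ : TangentBundle 𝓘(ℝ, E) M)))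
    (hs : ContMDiff 𝓘(ℝ, E) 𝓘(ℝ, ℝ) 2 s) (hWs : ∀ x, hnorm h x (W x) < s x) {x₀ : M}
    {u : TangentSpace 𝓘(ℝ, E) x₀} (hu : hnorm h x₀ (u - W x₀) = s x₀) :
    ∃ ε > 0, ∃ γ : ℝ → M, IsSolution h W s γ (Ioo (-ε) ε) ∧
      hnorm h (γ 0) (velocity E γ 0) = hnorm h x₀ u := by
  have hφ := chart_mem_atlas E x₀
  have hx₀ := mem_chart_source E x₀
  set φ := chartAt E x₀
  obtain ⟨y, v, μ, hy, hv, hμ, hext⟩ :=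
    exists_isExtremalAt_chartLagrangian hW hs hφ hx₀ ((hnorm_nonneg _).trans_lt (hWs x₀)) hu
  have hy₀ : y 0 ∈ φ.target := hy ▸ φ.map_source hx₀
  obtain ⟨hext₀, -, -, hμ₀⟩ := hext.self_of_nhds
  have hcont := hext₀.hasDerivAt.continuousAt
  obtain ⟨ε, hε, hall⟩ := Metric.eventually_nhds_iff_ball.1 <| hext.and <|
    (hcont.eventually (φ.open_target.mem_nhds hy₀)).and (hμ₀.eventually (lt_mem_nhds hμ))
  rw [Real.ball_eq_Ioo, zero_sub, zero_add] at hall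
  refine ⟨ε, hε, φ.symm ∘ y,
    isSolution_symm_comp hW hs hWs hφ isOpen_Ioo ordConnected_Ioo hall, ?_⟩
  have heq := eventuallyEq_chart_symm hcont hy₀
  rw [hnorm_velocity_eq_iff hφ ((φ.continuousAt_symm hy₀).comp hcont) (φ.map_target hy₀)
    (hext₀.hasDerivAt.congr_of_eventuallyEq heq) (hnorm_nonneg u), hnorm_sq,
    inner_eq_chartForm hφ hx₀, heq.self_of_nhds, hy, hv]

theorem isSolution_of_isGeodesicOfSpeed {c : ℝ} (hc : 0 < c) {J : Set ℝ} (hJ : IsOpen J)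
    (hJc : J.OrdConnected) {γ : ℝ → M} (hγ : IsGeodesicOfSpeed h c γ J) :
    IsSolution h 0 (fun _ => c) γ J := by
  refine isSolution_of_isExtremalAt (W := 0) (contMDiff_zeroSection ℝ _) contMDiff_const
    (fun x => by simpa [hnorm] using hc) hJc fun t₀ ht₀ => ?_
  obtain ⟨φ, hφ, hsrc, v, hv⟩ := isGeodesic_iff.1 hγ.1 t₀ ht₀
  have hcont : ∀ᶠ t in 𝓝 t₀, ContinuousAt γ t := by
    filter_upwards [hsrc.eventually_nhds, hv] with t hsrc hv
    exact continuousAt_of_chart hsrc hv.hasDerivAt_pos.continuousAt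
  refine ⟨hcont.self_of_nhds, φ, hφ, hsrc.self_of_nhds, v, fun _ => 1, continuousAt_const,
    one_pos, ?_⟩
  filter_upwards [hcont, hsrc, hv, hJ.mem_nhds ht₀] with t hcont hsrc hv htJ
  refine ⟨hv.hasDerivAt_vel.continuousAt, isExtremalAt_chartLagrangian_zero_const_iff.2
    (hv.isExtremalAt (isMetricAt_chartForm hφ (φ.map_source hsrc))), ?_⟩
  rw [chartLagrangian_zero_const_eval, sub_eq_zero]
  exact (hnorm_velocity_eq_iff hφ hcont hsrc hv.hasDerivAt_pos hc.le).1 (hγ.2 t htJ)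

theorem isSolution_iff_isGeodesicOfSpeed {c : ℝ} (hc : 0 < c) {J : Set ℝ} (hJ : IsOpen J)
    (hJc : J.OrdConnected) {γ : ℝ → M} :
    IsSolution h 0 (fun _ => c) γ J ↔ IsGeodesicOfSpeed h c γ J :=
  ⟨isGeodesicOfSpeed_of_isSolution hc hJ, isSolution_of_isGeodesicOfSpeed hc hJ hJc⟩

theorem inner_add_wind_eq_of_isGeodesicOfSpeed
    (hW : ContMDiff 𝓘(ℝ, E) 𝓘(ℝ, E).tangent 2 (fun x => (⟨x, W x⟩ : TangentBundle 𝓘(ℝ, E) M)))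
    (hs : ContMDiff 𝓘(ℝ, E) 𝓘(ℝ, ℝ) 2 s) (hWs : ∀ x, hnorm h x (W x) < s x) {c : ℝ}
    (hall : ∀ J : Set ℝ, IsOpen J → J.OrdConnected → ∀ γ : ℝ → M,
      IsSolution h W s γ J → IsGeodesicOfSpeed h c γ J) {x : M} {u : TangentSpace 𝓘(ℝ, E) x}
    (hu : h.inner x u u = s x ^ 2) : h.inner x (u + W x) (u + W x) = c ^ 2 := by
  have hsx : 0 ≤ s x := (hnorm_nonneg _).trans (hWs x).le
  obtain ⟨ε, hε, γ, hγ, hγ₀⟩ := exists_isSolution hW hs hWs (x₀ := x) (u := u + W x)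
    (by rwa [add_sub_cancel_right, hnorm_eq_iff u hsx])
  rw [← hnorm_sq, ← hγ₀, (hall _ isOpen_Ioo ordConnected_Ioo γ hγ).2 0 ⟨by linarith, hε⟩]

theorem wind_eq_zero_and_sq_eq_of_isGeodesicOfSpeed [Nontrivial E]
    (hW : ContMDiff 𝓘(ℝ, E) 𝓘(ℝ, E).tangent 2 (fun x => (⟨x, W x⟩ : TangentBundle 𝓘(ℝ, E) M)))
    (hs : ContMDiff 𝓘(ℝ, E) 𝓘(ℝ, ℝ) 2 s) (hWs : ∀ x, hnorm h x (W x) < s x) {c : ℝ}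
    (hall : ∀ J : Set ℝ, IsOpen J → J.OrdConnected → ∀ γ : ℝ → M,
      IsSolution h W s γ J → IsGeodesicOfSpeed h c γ J) (x : M) : W x = 0 ∧ s x ^ 2 = c ^ 2 := by
  have : Nontrivial (TangentSpace 𝓘(ℝ, E) x) := inferInstanceAs (Nontrivial E)
  exact eq_zero_and_sq_eq_of_apply_add_self_eq (B := (h.inner x).toBilinForm)
    (fun u v => h.symm x u v) (fun u hu => h.pos x u hu) ((hnorm_nonneg _).trans_lt (hWs x))
    fun u hu => inner_add_wind_eq_of_isGeodesicOfSpeed hW hs hWs hall hu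

theorem exists_forall_isSolution_iff_isGeodesicOfSpeed (hs : ∀ x, 0 < s x) (hW : ∀ x, W x = 0)
    {k : ℝ} (hk : ∀ x, s x ^ 2 = k) :
    ∃ c : ℝ, 0 < c ∧ ∀ (J : Set ℝ), IsOpen J → J.OrdConnected → ∀ γ : ℝ → M,
      (IsSolution h W s γ J ↔ IsGeodesicOfSpeed h c γ J) := by
  rcases isEmpty_or_nonempty M with hM | ⟨⟨x₀⟩⟩
  · exact ⟨1, one_pos, fun J _ _ γ => (hM.false (γ 0)).elim⟩
  obtain rfl : W = 0 := funext hW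
  obtain ⟨c, hc, rfl⟩ : ∃ c, 0 < c ∧ s = fun _ => c := ⟨s x₀, hs x₀, funext fun x =>
    (sq_eq_sq₀ (hs x).le (hs x₀).le).1 ((hk x).trans (hk x₀).symm)⟩
  exact ⟨c, hc, fun J hJ hJc γ => isSolution_iff_isGeodesicOfSpeed hc hJ hJc⟩

end Solutions

end Zermelo

theorem mainTheorem4_general
    {E : Type*} [NormedAddCommGroup E] [NormedSpace ℝ E] [FiniteDimensional ℝ E] [Nontrivial E]
    {M : Type*} [TopologicalSpace M] [T2Space M] [ChartedSpace E M] [IsManifold 𝓘(ℝ, E) ∞ M]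
    (h : Zermelo.Metric E M)
    (W : ∀ x : M, TangentSpace 𝓘(ℝ, E) x)
    (hW : ContMDiff 𝓘(ℝ, E) 𝓘(ℝ, E).tangent 2 (fun x => (⟨x, W x⟩ : TangentBundle 𝓘(ℝ, E) M)))
    (s : M → ℝ) (hs : ContMDiff 𝓘(ℝ, E) 𝓘(ℝ, ℝ) 2 s)
    (hWs : ∀ x, Zermelo.hnorm h x (W x) < s x) :
    ((∃ c : ℝ, 0 < c ∧ ∀ (J : Set ℝ), IsOpen J → J.OrdConnected → ∀ γ : ℝ → M,
        Zermelo.IsSolution h W s γ J → Zermelo.IsGeodesicOfSpeed h c γ J) ↔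
      (∀ x, W x = 0) ∧ ∃ k : ℝ, ∀ x, s x ^ 2 = k) ∧
    ((∃ c : ℝ, 0 < c ∧ ∀ (J : Set ℝ), IsOpen J → J.OrdConnected → ∀ γ : ℝ → M,
        (Zermelo.IsSolution h W s γ J ↔ Zermelo.IsGeodesicOfSpeed h c γ J)) ↔
      (∀ x, W x = 0) ∧ ∃ k : ℝ, ∀ x, s x ^ 2 = k) := by
  have hs₀ : ∀ x, 0 < s x := fun x => (Zermelo.hnorm_nonneg _).trans_lt (hWs x)
  have hforward : (∃ c : ℝ, 0 < c ∧ ∀ (J : Set ℝ), IsOpen J → J.OrdConnected → ∀ γ : ℝ → M,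
      Zermelo.IsSolution h W s γ J → Zermelo.IsGeodesicOfSpeed h c γ J) →
      (∀ x, W x = 0) ∧ ∃ k : ℝ, ∀ x, s x ^ 2 = k := fun ⟨_, _, hall⟩ =>
    have hzero := Zermelo.wind_eq_zero_and_sq_eq_of_isGeodesicOfSpeed hW hs hWs hall
    ⟨fun x => (hzero x).1, _, fun x => (hzero x).2⟩
  refine ⟨⟨hforward, fun ⟨hW₀, k, hk⟩ => ?_⟩, fun ⟨c, hc, hiff⟩ =>
    hforward ⟨c, hc, fun J hJ hJc γ => (hiff J hJ hJc γ).1⟩, fun ⟨hW₀, k, hk⟩ =>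
      Zermelo.exists_forall_isSolution_iff_isGeodesicOfSpeed hs₀ hW₀ hk⟩
  obtain ⟨c, hc, hiff⟩ := Zermelo.exists_forall_isSolution_iff_isGeodesicOfSpeed hs₀ hW₀ hk
  exact ⟨c, hc, fun J hJ hJc γ => (hiff J hJ hJc γ).1⟩

theorem mainTheorem4
    {E : Type*} [NormedAddCommGroup E] [NormedSpace ℝ E] [FiniteDimensional ℝ E] [Nontrivial E]
    {M : Type*} [TopologicalSpace M] [T2Space M] [ChartedSpace E M] [IsManifold 𝓘(ℝ, E) ∞ M]
    (h : Zermelo.Metric E M)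
    (W : ∀ x : M, TangentSpace 𝓘(ℝ, E) x)
    (hW : ContMDiff 𝓘(ℝ, E) 𝓘(ℝ, E).tangent ∞ (fun x => (⟨x, W x⟩ : TangentBundle 𝓘(ℝ, E) M)))
    (s : M → ℝ) (hs : ContMDiff 𝓘(ℝ, E) 𝓘(ℝ, ℝ) ∞ s)
    (hs1 : ∀ x, s x ≤ 1) (hWs : ∀ x, Zermelo.hnorm h x (W x) < s x) :
    ((∃ c : ℝ, 0 < c ∧ ∀ (J : Set ℝ), IsOpen J → J.OrdConnected → ∀ γ : ℝ → M,
        Zermelo.IsSolution h W s γ J → Zermelo.IsGeodesicOfSpeed h c γ J) ↔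
      (∀ x, W x = 0) ∧ ∃ k : ℝ, ∀ x, s x ^ 2 = k) ∧
    ((∃ c : ℝ, 0 < c ∧ ∀ (J : Set ℝ), IsOpen J → J.OrdConnected → ∀ γ : ℝ → M,
        (Zermelo.IsSolution h W s γ J ↔ Zermelo.IsGeodesicOfSpeed h c γ J)) ↔
      (∀ x, W x = 0) ∧ ∃ k : ℝ, ∀ x, s x ^ 2 = k) :=
  mainTheorem4_general h W (hW.of_le (by norm_cast)) s (hs.of_le (by norm_cast)) hWs
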